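/- Let $\rho:\mathfrak g\to\mathfrak{gl}(V)$ be a finite-dimensional representation of a finite-dimensional complex Lie algebra. For $x\in V$ let $R_x:\mathfrak g\to V$, $R_x\xi=\rho(\xi)x$, let $r=\dim\mathcal O_{\mathrm{reg}}=\max_x\operatorname{rk}R_x$ and $q=\operatorname{codim}\mathcal O_{\mathrm{reg}}=\dim V-r$. A point $x$ is regular if $\dim\operatorname{Ker}R_x$ is minimal. A polynomial $f$ on $V$ is an invariant of $\rho$ if $R_x^*(df(x))=0$ for all $x\in V$. Let $p_1,\dots,p_N$ be the $r\times r$ minors of the matrix of $R_x$ (in fixed bases of $\mathfrak g$ and $V$) that do not vanish identically, regarded as polynomials in $x$; let $\mathsf p_\rho$ be their greatest common divisor, write $p_i=\mathsf p_\rho h_i$, and put $\mathsf{Sing}_1=\{x\in V: h_1(x)=\dots=h_N(x)=0\}$. The total Kronecker $v$-index $\mathsf k_{\mathrm{vert}}$ of a pencil $A+\lambda B$ of linear maps is $\sum_j(\eta_j+1)$, the total number of rows of the vertical Kronecker blocks (of sizes $(\eta_j+1)\times\eta_j$, $\eta_j\ge 0$) in its Kronecker canonical form. The algebraic type of a pencil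 consists of its minimal row and column indices, the number of distinct eigenvalues (in $\mathbb C\cup\{\infty\}$) of its Jordan blocks, and the number and sizes of the Jordan blocks for each eigenvalue. A pair $(x,a)\in V\times V$ is generic if it lies in a non-empty Zariski open subset of $V\times V$ on which the algebraic type of the pencil $R_x+\lambda R_a$ is constant, and $\mathsf k_{\mathrm{vert}}(\rho)$ is the total Kronecker $v$-index of $R_x+\lambda R_a$ for a generic pair $(x,a)$. Proposition. Let $f_1,\dots,f_q$, $q=\operatorname{codim}\mathcal O_{\mathrm{reg}}$, be algebraically independent homogeneous invariant polynomials of $\rho$ such that $$\sum_{\alpha=1}^q\deg f_\alpha=\mathsf k_{\mathrm{vert}}(\rho).$$ Then at every point $x\notin\mathsf{Sing}_1$ the differentials $df_1(x),\dots,df_q(x)\in V^*$ are linearly independent. In particular, they are linearly independent at every regular point $x\in V$. -/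

import Mathlib

/-! `Module.End ℂ V` carries the commutator bracket, that is, it is `gl(V)`. -/
attribute [local instance] LieRing.ofAssociativeRing

namespace JordanKronecker

/-! ### Pencils of linear maps and their Kronecker canonical form -/

/-- The blocks of the canonical form of a pencil `A + λ B` over `ℂ`. An eigenvalue is an element of
`Option ℂ`, where `none` is the eigenvalue infinity. -/
inductive Block where
  /-- The Jordan block of size `(n + 1) × (n + 1)` with the given eigenvalue. -/
  | jordan (eigenvalue : Option ℂ) (n : ℕ)
  /-- The horizontal Kronecker block of size `ε × (ε + 1)`. -/
  | horizontal (ε : ℕ)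
  /-- The vertical Kronecker block of size `(η + 1) × η`. -/
  | vertical (η : ℕ)

namespace Block

/-- The number of rows of a block. -/
def rows : Block → ℕ
  | jordan _ n => n + 1
  | horizontal ε => ε
  | vertical η => η + 1

/-- The number of columns of a block. -/
def cols : Block → ℕ
  | jordan _ n => n + 1
  | horizontal ε => ε + 1
  | vertical η => η

/-- The matrix with ones at the places `(i, i)` and zeros elsewhere. -/
def diagOnes (m n : ℕ) : Matrix (Fin m) (Fin n) ℂ :=
  Matrix.of fun i j => if (i : ℕ) = (j : ℕ) then 1 else 0

/-- The matrix with ones at the places `(i, i + 1)` and zeros elsewhere. -/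
def superOnes (m n : ℕ) : Matrix (Fin m) (Fin n) ℂ :=
  Matrix.of fun i j => if (i : ℕ) + 1 = (j : ℕ) then 1 else 0

/-- The matrix with ones at the places `(j + 1, j)` and zeros elsewhere. -/
def subOnes (m n : ℕ) : Matrix (Fin m) (Fin n) ℂ :=
  Matrix.of fun i j => if (i : ℕ) = (j : ℕ) + 1 then 1 else 0

/-- The first matrix of the canonical pencil of a block. -/
def matA : (β : Block) → Matrix (Fin β.rows) (Fin β.cols) ℂ
  | jordan (some z) n => z • diagOnes (n + 1) (n + 1) + superOnes (n + 1) (n + 1)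
  | jordan none n => diagOnes (n + 1) (n + 1)
  | horizontal ε => diagOnes ε (ε + 1)
  | vertical η => diagOnes (η + 1) η

/-- The second matrix of the canonical pencil of a block. -/
def matB : (β : Block) → Matrix (Fin β.rows) (Fin β.cols) ℂ
  | jordan (some _) n => diagOnes (n + 1) (n + 1)
  | jordan none n => superOnes (n + 1) (n + 1)
  | horizontal ε => superOnes ε (ε + 1)
  | vertical η => subOnes (η + 1) η

/-- The contribution of a block to the total Kronecker `v`-index: the number of rows `η + 1` if the
block is vertical, and zero otherwise. -/
def vRows : Block → ℕ
  | vertical η => η + 1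
  | _ => 0

/-- Change the eigenvalue of a Jordan block; Kronecker blocks are left unchanged. -/
def relabel (σ : Option ℂ → Option ℂ) : Block → Block
  | jordan z n => jordan (σ z) n
  | horizontal ε => horizontal ε
  | vertical η => vertical η

end Block

section Pencil

variable {U V : Type*} [AddCommGroup U] [Module ℂ U] [AddCommGroup V] [Module ℂ V]

/-- In suitable bases of `U` and `V` the matrices of `A` and `B` are block-diagonal with the
canonical blocks of the list `L`. (A zero block of size `g × h` is the sum of `g` vertical blocks of
size `1 × 0` and `h` horizontal blocks of size `0 × 1`.) -/
def IsKroneckerForm (A B : U →ₗ[ℂ] V) (L : List Block) : Prop :=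
  ∃ (bU : Module.Basis (Σ i : Fin L.length, Fin (L.get i).cols) ℂ U)
    (bV : Module.Basis (Σ i : Fin L.length, Fin (L.get i).rows) ℂ V),
    LinearMap.toMatrix bU bV A = Matrix.blockDiagonal' (fun i => (L.get i).matA) ∧
    LinearMap.toMatrix bU bV B = Matrix.blockDiagonal' (fun i => (L.get i).matB)

open Classical in
/-- The total Kronecker `v`-index of the pencil `A + λ B`: the total number `∑ (η_j + 1)` of rows in
the vertical blocks of its canonical form. (For finite-dimensional spaces a canonical form exists
and is unique up to the order of the blocks; the value `0` is used if there is none.) -/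
noncomputable def pencilVIndex (A B : U →ₗ[ℂ] V) : ℕ :=
  if h : ∃ L : List Block, IsKroneckerForm A B L then (h.choose.map Block.vRows).sum else 0

/-- Two pencils have the same algebraic type: the same minimal row and column indices, and, after a
relabelling of the eigenvalues, the same Jordan blocks for each eigenvalue. -/
def SameAlgebraicType (A B A' B' : U →ₗ[ℂ] V) : Prop :=
  ∃ L L' : List Block, IsKroneckerForm A B L ∧ IsKroneckerForm A' B' L' ∧
    ∃ σ : Equiv.Perm (Option ℂ), (L.map (Block.relabel σ)).Perm L'

end Pencil

/-- Zariski open subsets of a finite-dimensional complex vector space `W`: the union of the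
non-vanishing sets of a family of polynomials. Without choosing coordinates, a polynomial function
is a polynomial expression in linear functionals on `W`. -/
def IsZariskiOpen {W : Type*} [AddCommGroup W] [Module ℂ W] (S : Set W) : Prop :=
  ∃ T : Set (MvPolynomial (Module.Dual ℂ W) ℂ),
    S = {w | ∃ P ∈ T, MvPolynomial.eval (fun φ : Module.Dual ℂ W => φ w) P ≠ 0}

section Representation

variable {𝔤 V : Type*} [LieRing 𝔤] [LieAlgebra ℂ 𝔤] [AddCommGroup V] [Module ℂ V]

/-! ### The operators `R_x` -/

/-- The operator `R_x : 𝔤 → V`, `R_x ξ = ρ(ξ) x`. -/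
def R (ρ : 𝔤 →ₗ⁅ℂ⁆ Module.End ℂ V) (x : V) : 𝔤 →ₗ[ℂ] V :=
  (ρ : 𝔤 →ₗ[ℂ] Module.End ℂ V).flip x

/-- A point is regular if its stabiliser `Ker R_a` has the least possible dimension. -/
def IsRegular (ρ : 𝔤 →ₗ⁅ℂ⁆ Module.End ℂ V) (a : V) : Prop :=
  ∀ x : V, Module.finrank ℂ (LinearMap.ker (R ρ a)) ≤ Module.finrank ℂ (LinearMap.ker (R ρ x))

/-- The dimension of a regular orbit, the maximum over `x` of the rank of `R_x`. -/
noncomputable def dimRegularOrbit (ρ : 𝔤 →ₗ⁅ℂ⁆ Module.End ℂ V) : ℕ :=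
  ⨆ x : V, Module.finrank ℂ (LinearMap.range (R ρ x))

/-- The codimension of a regular orbit. -/
noncomputable def codimRegularOrbit (ρ : 𝔤 →ₗ⁅ℂ⁆ Module.End ℂ V) : ℕ :=
  Module.finrank ℂ V - dimRegularOrbit ρ

/-! ### The total Kronecker `v`-index of a representation -/

/-- A pair `(x, a)` is generic if it has a Zariski open neighbourhood in `V × V` on which the
algebraic type of the pencil `R_x + λ R_a` is constant. -/
def IsGenericPair (ρ : 𝔤 →ₗ⁅ℂ⁆ Module.End ℂ V) (x a : V) : Prop :=
  ∃ S : Set (V × V), IsZariskiOpen S ∧ (x, a) ∈ S ∧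
    ∀ p ∈ S, ∀ p' ∈ S, SameAlgebraicType (R ρ p.1) (R ρ p.2) (R ρ p'.1) (R ρ p'.2)

open Classical in
/-- The total Kronecker `v`-index of `ρ`: that of the pencil `R_x + λ R_a` of a generic pair
`(x, a)`. (Generic pairs always exist, and all of them give the same value.) -/
noncomputable def vIndex (ρ : 𝔤 →ₗ⁅ℂ⁆ Module.End ℂ V) : ℕ :=
  if h : ∃ p : V × V, IsGenericPair ρ p.1 p.2 then
    pencilVIndex (R ρ h.choose.1) (R ρ h.choose.2)
  else 0

/-! ### Polynomials on `V`, in the linear coordinates given by a basis -/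

variable {ι κ : Type*} [Fintype ι] [Fintype κ]

/-- The differential at `x` of the polynomial `f` on `V`, as an element of the dual space. -/
noncomputable def differential (b : Module.Basis ι ℂ V) (f : MvPolynomial ι ℂ) (x : V) :
    Module.Dual ℂ V :=
  ∑ i, MvPolynomial.eval (b.repr x) (MvPolynomial.pderiv i f) • b.coord i

/-- The polynomial `f` on `V` is an invariant of `ρ`: `R_x^* (df(x)) = 0` for all `x`. -/
def IsInvariant (ρ : 𝔤 →ₗ⁅ℂ⁆ Module.End ℂ V) (b : Module.Basis ι ℂ V) (f : MvPolynomial ι ℂ) :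
    Prop :=
  ∀ x : V, (R ρ x).dualMap (differential b f x) = 0

/-! ### The fundamental semi-invariant and the set `Sing₁` -/

/-- The matrix of `R_x` in the bases `c` of `𝔤` and `b` of `V`, with entries regarded as
polynomials in the coordinates of `x`. -/
noncomputable def genericMatrix (ρ : 𝔤 →ₗ⁅ℂ⁆ Module.End ℂ V) (b : Module.Basis ι ℂ V)
    (c : Module.Basis κ ℂ 𝔤) : Matrix ι κ (MvPolynomial ι ℂ) :=
  Matrix.of fun i j =>
    ∑ k, MvPolynomial.C (b.repr (ρ (c j) (b k)) i) * MvPolynomial.X k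

/-- The minors of size `r × r` of the matrix of `R_x`, where `r` is the dimension of a regular
orbit, as polynomials in the coordinates of `x`. -/
noncomputable def minor (ρ : 𝔤 →ₗ⁅ℂ⁆ Module.End ℂ V) (b : Module.Basis ι ℂ V)
    (c : Module.Basis κ ℂ 𝔤)
    (s : (Fin (dimRegularOrbit ρ) ↪ ι) × (Fin (dimRegularOrbit ρ) ↪ κ)) : MvPolynomial ι ℂ :=
  ((genericMatrix ρ b c).submatrix s.1 s.2).det

theorem exists_gcd {α R : Type*} [Finite α] [CommRing R] [IsDomain R]
    [UniqueFactorizationMonoid R] (m : α → R) :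
    ∃ p : R, (∀ s, p ∣ m s) ∧ ∀ d : R, (∀ s, d ∣ m s) → d ∣ p := by
  classical
  have := Fintype.ofFinite α
  let _ : NormalizedGCDMonoid R :=
    Classical.choice (inferInstance : Nonempty (NormalizedGCDMonoid R))
  exact ⟨Finset.univ.gcd m, fun s => Finset.gcd_dvd (Finset.mem_univ s),
    fun d hd => Finset.dvd_gcd fun s _ => hd s⟩

/-- The fundamental semi-invariant of `ρ`: the greatest common divisor of the minors of size
`r × r` of the matrix of `R_x` (determined up to a non-zero constant factor). -/
noncomputable def fundamentalSemiInvariant (ρ : 𝔤 →ₗ⁅ℂ⁆ Module.End ℂ V) (b : Module.Basis ι ℂ V)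
    (c : Module.Basis κ ℂ 𝔤) : MvPolynomial ι ℂ :=
  (exists_gcd (minor ρ b c)).choose

/-- The set `Sing₁`: the common zeros of the quotients `h` of the minors of size `r × r` that do not
vanish identically by the fundamental semi-invariant. -/
def Sing₁ (ρ : 𝔤 →ₗ⁅ℂ⁆ Module.End ℂ V) (b : Module.Basis ι ℂ V) (c : Module.Basis κ ℂ 𝔤) :
    Set V :=
  {x | ∀ s, minor ρ b c s ≠ 0 → ∀ h : MvPolynomial ι ℂ,
    minor ρ b c s = fundamentalSemiInvariant ρ b c * h → MvPolynomial.eval (b.repr x) h = 0}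

end Representation

end JordanKronecker

/-! Let `n = dim V`, let `F` be the `q × n` Jacobian matrix of the invariants and `M` the generic
matrix of `R_x`. Invariance says `F * M = 0`, so for any `r` columns `J` of `M` the maximal minors
of `F` are proportional to the complementary `r × r` minors of `M_J` (`completeDet_mul_det`).
Polynomials form a factorial ring, so both families are multiples of one primitive vector `u`: the
minors of `F` are `g * u` and those of `M_J` are `w J * u` (`exists_primitive_vector`). Primitivity
also gives `p ∣ w J` for the fundamental semi-invariant `p`. Hence each quotient `h` is, up to sign,
a multiple of a coordinate of `u`, and `u` does not vanish at a point outside `Sing₁`. The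
differentials are independent there as soon as `g` is a constant.

That `g` is constant is a degree count (`isUnit_of_det_jacobian_mul_eq`). On a generic line `x + λ
a` the left kernel of the pencil has a polynomial basis, read off from the vertical blocks, with one
maximal minor equal to `1` and another equal to `(-λ)^(∑ η_j)`
(`IsKroneckerForm.exists_left_kernel`). Restricted to the line, `u` is proportional to these minors,
so it has a coordinate of degree at least `∑ η_j`. The same coordinate of `g * u` has degree at most
`∑ (deg f_α - 1)`, which the degree hypothesis makes equal to `∑ η_j`, because there are exactly `q`
vertical blocks. So `deg g = 0`.

Two inputs remain: algebraically independent polynomials have a nonzero Jacobian minor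
(`exists_jacobian_minor_ne_zero`), and the line of a generic pair contains a point of maximal rank
(`IsGenericPair.exists_finrank_range_eq`), which gives the number of vertical blocks. -/

namespace JordanKronecker

open Matrix

/-! ### Complementary minors and primitive vectors -/

section Determinants

variable {A : Type*} [CommRing A] {ι : Type*} [Fintype ι] [DecidableEq ι] {r q : ℕ}

/-- The matrix whose columns are the standard basis vectors indexed by the right part of a
splitting `e` of the index set. -/
def selectCols (A : Type*) [CommRing A] (e : Fin r ⊕ Fin q ≃ ι) : Matrix ι (Fin q) A :=
  Matrix.of fun i j => if i = e (Sum.inr j) then 1 else 0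

/-- The determinant of the square matrix `[M | C]`, the rows being ordered by `e₀`. -/
def completeDet (e₀ : Fin r ⊕ Fin q ≃ ι) (M : Matrix ι (Fin r) A) (C : Matrix ι (Fin q) A) : A :=
  ((fromCols M C).submatrix e₀ id).det

theorem mul_selectCols (F : Matrix (Fin q) ι A) (e : Fin r ⊕ Fin q ≃ ι) :
    F * selectCols A e = F.submatrix id (fun j => e (Sum.inr j)) := by
  ext i j
  simp [selectCols, Matrix.mul_apply]

-- Reordering the rows by `e` makes the matrix block lower triangular with an identity block; the
-- reordering costs a sign.
omit [Fintype ι] in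
theorem completeDet_selectCols (e₀ e : Fin r ⊕ Fin q ≃ ι) (M : Matrix ι (Fin r) A) :
    completeDet e₀ M (selectCols A e) =
      ((Equiv.Perm.sign (e₀.trans e.symm) : ℤ) : A) *
        (M.submatrix (fun i => e (Sum.inl i)) id).det := by
  have h1 : (fromCols M (selectCols A e)).submatrix e₀ id =
      ((fromCols M (selectCols A e)).submatrix e id).submatrix (e₀.trans e.symm) id := by
    ext i j; simp
  have h2 : (fromCols M (selectCols A e)).submatrix e id =
      fromBlocks (M.submatrix (fun i => e (Sum.inl i)) id) 0
        (M.submatrix (fun i => e (Sum.inr i)) id) 1 := by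
    ext (i | i) (j | j) <;> simp [selectCols, Matrix.one_apply]
  rw [completeDet, h1, Matrix.det_permute, h2, Matrix.det_fromBlocks_zero₁₂, Matrix.det_one,
    mul_one]

omit [Fintype ι] [DecidableEq ι] in
theorem completeDet_map {B : Type*} [CommRing B] (φ : A →+* B) (e₀ : Fin r ⊕ Fin q ≃ ι)
    (M : Matrix ι (Fin r) A) (C : Matrix ι (Fin q) A) :
    completeDet e₀ (M.map φ) (C.map φ) = φ (completeDet e₀ M C) := by
  rw [completeDet, completeDet, RingHom.map_det]
  congr 1
  ext i (j | j) <;> simp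

-- The columns of `[M | C]` form a basis, so `C' = M * Z₁ + C * Z₂`. Since `F` kills `M`, passing
-- from `C` to `C'` multiplies both `det (F * C)` and `det [M | C]` by `det Z₂`.
omit [DecidableEq ι] in
theorem completeDet_mul_det_of_ne_zero {K : Type*} [Field K] (e₀ : Fin r ⊕ Fin q ≃ ι)
    (M : Matrix ι (Fin r) K) (F : Matrix (Fin q) ι K) (hF : F * M = 0) (C C' : Matrix ι (Fin q) K)
    (hC : completeDet e₀ M C ≠ 0) :
    completeDet e₀ M C * (F * C').det = completeDet e₀ M C' * (F * C).det := by
  set N := (fromCols M C).submatrix e₀ id with hN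
  have hu : IsUnit N.det := isUnit_iff_ne_zero.mpr hC
  set Z := N⁻¹ * (C'.submatrix e₀ id) with hZ
  have hNZ : N * Z = C'.submatrix e₀ id := by
    rw [hZ, ← Matrix.mul_assoc, Matrix.mul_nonsing_inv _ hu, Matrix.one_mul]
  have hC' : C' = M * Z.toRows₁ + C * Z.toRows₂ := by
    rw [← fromCols_mul_fromRows, fromRows_toRows]
    ext i j
    have := congrFun (congrFun hNZ (e₀.symm i)) j
    simpa [N, Matrix.mul_apply] using this.symm
  have h1 : F * C' = F * C * Z.toRows₂ := by
    rw [hC', Matrix.mul_add, ← Matrix.mul_assoc, hF, Matrix.zero_mul, zero_add, Matrix.mul_assoc]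
  have h2 : (fromCols M C').submatrix e₀ id =
      N * fromBlocks 1 Z.toRows₁ 0 Z.toRows₂ := by
    have : fromCols M C' = fromCols M C * fromBlocks 1 Z.toRows₁ 0 Z.toRows₂ := by
      rw [fromCols_mul_fromBlocks, ← hC']; simp
    rw [this, hN]
    ext i j
    simp [Matrix.mul_apply]
  rw [h1, Matrix.det_mul, completeDet, completeDet, h2, Matrix.det_mul,
    Matrix.det_fromBlocks_zero₂₁, Matrix.det_one]
  ring

omit [DecidableEq ι] in
/-- If the rows of `F` annihilate the columns of `M`, the maximal minors of `F` are proportional to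
the complementary maximal minors of `M`. -/
theorem completeDet_mul_det [IsDomain A] (e₀ : Fin r ⊕ Fin q ≃ ι)
    (M : Matrix ι (Fin r) A) (F : Matrix (Fin q) ι A) (hF : F * M = 0)
    (C C' : Matrix ι (Fin q) A) :
    completeDet e₀ M C * (F * C').det = completeDet e₀ M C' * (F * C).det := by
  set φ := algebraMap A (FractionRing A)
  have hφ : Function.Injective φ := IsFractionRing.injective A (FractionRing A)
  have hF' : F.map φ * M.map φ = 0 := by
    rw [← Matrix.map_mul, hF]; ext; simp
  apply hφ
  simp only [map_mul, ← completeDet_map, RingHom.map_det, RingHom.mapMatrix_apply, Matrix.map_mul]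
  -- The relation is symmetric in `C` and `C'`, so over the fraction field one nonvanishing
  -- determinant suffices; if both vanish, both sides are zero.
  by_cases h : completeDet e₀ (M.map φ) (C.map φ) = 0
  · by_cases h' : completeDet e₀ (M.map φ) (C'.map φ) = 0
    · rw [h, h', zero_mul, zero_mul]
    · exact (completeDet_mul_det_of_ne_zero e₀ _ _ hF' _ _ h').symm
  · exact completeDet_mul_det_of_ne_zero e₀ _ _ hF' _ _ h

-- Cauchy–Binet before symmetrisation: multilinearity alone, with the vanishing terms for
-- non-injective `k` kept.
omit [DecidableEq ι] in
theorem det_mul_eq_sum (F : Matrix (Fin q) ι A) (C : Matrix ι (Fin q) A) :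
    (F * C).det = ∑ k : Fin q → ι, (∏ j, C (k j) j) * (F.submatrix id k).det := by
  rw [← Matrix.det_transpose]
  have h : (F * C)ᵀ = fun j => ∑ i, C i j • Fᵀ i := by
    ext j a
    simp [Matrix.mul_apply, mul_comm]
  change Matrix.detRowAlternating _ = _
  rw [h]
  refine (MultilinearMap.map_sum (Matrix.detRowAlternating (n := Fin q) (R := A)).toMultilinearMap
    fun j i => C i j • Fᵀ i).trans (Finset.sum_congr rfl fun k _ => ?_)
  rw [MultilinearMap.map_smul_univ, smul_eq_mul, ← Matrix.det_transpose (F.submatrix id k)]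
  rfl

theorem exists_equiv_inr (hcard : Fintype.card ι = r + q) (k : Fin q → ι)
    (hk : Function.Injective k) : ∃ e : Fin r ⊕ Fin q ≃ ι, ∀ j, e (Sum.inr j) = k j := by
  classical
  have h1 : Fintype.card {i // i ∉ Set.range k} = Fintype.card (Fin r) := by
    rw [Fintype.card_subtype_compl, hcard, Fintype.card_fin]
    have : Fintype.card {i // i ∈ Set.range k} = q := by
      rw [← Fintype.card_congr (Equiv.ofInjective k hk), Fintype.card_fin]
    omega
  let e1 := Fintype.equivOfCardEq h1
  refine ⟨(Equiv.sumCongr e1.symm (Equiv.ofInjective k hk)).trans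
    ((Equiv.sumComm _ _).trans (Equiv.Set.sumCompl (Set.range k))), fun j => ?_⟩
  exact Equiv.Set.sumCompl_apply_inl (Set.range k) ⟨k j, Set.mem_range_self j⟩

theorem exists_equiv_inl (hcard : Fintype.card ι = r + q) (k : Fin r → ι)
    (hk : Function.Injective k) : ∃ e : Fin r ⊕ Fin q ≃ ι, ∀ j, e (Sum.inl j) = k j := by
  obtain ⟨e, he⟩ := exists_equiv_inr (r := q) (q := r) (by omega) k hk
  exact ⟨(Equiv.sumComm _ _).trans e, fun j => by simpa using he j⟩

/-- Allows division by the gcd of the coordinate minors for an arbitrary `C`. This matters because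
the columns used in the degree count come from a basis adapted to the canonical form, not from `b`.
-/
theorem dvd_det_mul (hcard : Fintype.card ι = r + q) (F : Matrix (Fin q) ι A) (g : A)
    (hg : ∀ e : Fin r ⊕ Fin q ≃ ι, g ∣ (F * selectCols A e).det) (C : Matrix ι (Fin q) A) :
    g ∣ (F * C).det := by
  rw [det_mul_eq_sum]
  refine Finset.dvd_sum fun k _ => Dvd.dvd.mul_left ?_ _
  by_cases hk : Function.Injective k
  · obtain ⟨e, he⟩ := exists_equiv_inr hcard k hk
    have := hg e
    rw [mul_selectCols] at this
    simpa only [he] using this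
  · obtain ⟨i, j, hij, hne⟩ : ∃ i j, k i = k j ∧ i ≠ j := by
      simpa [Function.Injective] using hk
    rw [Matrix.det_zero_of_column_eq hne (fun a => by simp [hij])]
    exact dvd_zero g

/-- Over a unique factorization domain, the maximal minors of `F` and the complementary maximal
minors of matrices annihilated by `F` are all multiples of one primitive vector `u`. -/
theorem exists_primitive_vector [IsDomain A] [UniqueFactorizationMonoid A]
    (e₀ : Fin r ⊕ Fin q ≃ ι)
    {τ : Type*} (M : τ → Matrix ι (Fin r) A) (F : Matrix (Fin q) ι A) (hF : ∀ J, F * M J = 0)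
    (hne : ∃ e : Fin r ⊕ Fin q ≃ ι, (F * selectCols A e).det ≠ 0) :
    ∃ (g : A) (u : Matrix ι (Fin q) A → A) (w : τ → A), g ≠ 0 ∧
      (∀ C, (F * C).det = g * u C) ∧ (∀ J C, completeDet e₀ (M J) C = w J * u C) ∧
      ∀ (p : A) (J : τ), (∀ e : Fin r ⊕ Fin q ≃ ι, p ∣ completeDet e₀ (M J) (selectCols A e)) → p ∣ w J := by
  classical
  let _ : NormalizedGCDMonoid A :=
    Classical.choice (inferInstance : Nonempty (NormalizedGCDMonoid A))
  -- Primitivity in use: a common divisor of all `a * v e` divides `a`, since the `v e` have gcd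
  -- `1`.
  have gcd_one : ∀ (a p : A) (v : (Fin r ⊕ Fin q ≃ ι) → A), Finset.univ.gcd v = 1 →
      (∀ e, p ∣ a * v e) → p ∣ a := by
    intro a p v hv h
    have h1 : ∀ s : Finset (Fin r ⊕ Fin q ≃ ι), p ∣ a * s.gcd v := by
      intro s
      induction s using Finset.induction_on with
      | empty => simp
      | insert e s _ ih =>
        rw [Finset.gcd_insert]
        exact (dvd_gcd (h e) ih).trans (gcd_mul_left' a (v e) (s.gcd v)).dvd
    simpa [hv] using h1 Finset.univ
  have hcard : Fintype.card ι = r + q := by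
    rw [← Fintype.card_congr e₀, Fintype.card_sum, Fintype.card_fin, Fintype.card_fin]
  obtain ⟨e₁, he₁⟩ := hne
  obtain ⟨v, hv, hv1⟩ := Finset.extract_gcd (s := Finset.univ)
    (fun e : Fin r ⊕ Fin q ≃ ι => (F * selectCols A e).det) ⟨e₁, Finset.mem_univ _⟩
  set g := Finset.univ.gcd fun e : Fin r ⊕ Fin q ≃ ι => (F * selectCols A e).det with hg
  have hdvd : ∀ C : Matrix ι (Fin q) A, g ∣ (F * C).det :=
    dvd_det_mul hcard F g fun e => Finset.gcd_dvd (Finset.mem_univ e)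
  choose u hu using hdvd
  have hg0 : g ≠ 0 := by
    rintro h0
    exact he₁ (by rw [hu, h0, zero_mul])
  have huv : ∀ e, u (selectCols A e) = v e := fun e =>
    mul_left_cancel₀ hg0 ((hu _).symm.trans (hv e (Finset.mem_univ e)))
  have hu1 : u (selectCols A e₁) ≠ 0 := by
    intro h0
    exact he₁ (by rw [hu, h0, mul_zero])
  have hrel : ∀ (J : τ) (C C' : Matrix ι (Fin q) A), completeDet e₀ (M J) C * u C' = completeDet e₀ (M J) C' * u C := by
    intro J C C'
    have := completeDet_mul_det e₀ (M J) F (hF J) C C'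
    rw [hu, hu] at this
    refine mul_left_cancel₀ hg0 ?_
    linear_combination this
  -- By proportionality, `u` at `e₁` divides the minor at `e₁` times every `v e`, hence the minor
  -- itself; the quotient is `w J`.
  have hw : ∀ J, u (selectCols A e₁) ∣ completeDet e₀ (M J) (selectCols A e₁) := by
    intro J
    refine gcd_one _ _ v hv1 fun e => ?_
    rw [← huv, hrel]
    exact dvd_mul_left _ _
  choose w hw using hw
  have hwu : ∀ (J : τ) (C : Matrix ι (Fin q) A), completeDet e₀ (M J) C = w J * u C := by
    intro J C
    refine mul_right_cancel₀ hu1 ?_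
    rw [hrel, hw]
    ring
  refine ⟨g, u, w, hg0, hu, hwu, fun p J hp => gcd_one _ _ v hv1 fun e => ?_⟩
  rw [← huv, ← hwu]
  exact hp e

end Determinants

/-! ### Rank and nonzero minors -/

section Rank

variable {K : Type*} [Field K] {ι κ : Type*} [Fintype ι] [Fintype κ]

theorem exists_submatrix_linearIndependent (M : Matrix ι κ K) :
    ∃ J : Fin M.rank → κ, LinearIndependent K (fun j => M.col (J j)) := by
  rw [Matrix.rank_eq_finrank_span_cols]
  obtain ⟨f, hf, -, hli⟩ := Submodule.exists_fun_fin_finrank_span_eq K (Set.range M.col)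
  choose J hJ using hf
  exact ⟨J, by simpa only [hJ] using hli⟩

/-- Independent columns are chosen first, then independent rows among the restrictions to these
columns. -/
theorem exists_minor_ne_zero (M : Matrix ι κ K) {r : ℕ} (hr : M.rank = r) :
    ∃ (I : Fin r ↪ ι) (J : Fin r ↪ κ), (M.submatrix I J).det ≠ 0 := by
  subst hr
  obtain ⟨J, hJ⟩ := exists_submatrix_linearIndependent M
  have hJi : Function.Injective J := fun a b hab => hJ.injective (by simp [hab])
  set N := (M.submatrix id J)ᵀ with hN
  have hNr : N.rank = M.rank := by
    have := LinearIndependent.rank_matrix (M := N) (by exact hJ)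
    simpa using this
  obtain ⟨I, hI⟩ := exists_submatrix_linearIndependent N
  let I' : Fin M.rank → ι := fun i => I (Fin.cast hNr.symm i)
  have hI' : LinearIndependent K (fun i => N.col (I' i)) :=
    hI.comp _ (Fin.cast_injective _)
  refine ⟨⟨I', fun a b hab => hI'.injective (by simp [hab])⟩, ⟨J, hJi⟩, ?_⟩
  have h := Matrix.linearIndependent_rows_iff_isUnit (A := M.submatrix I' J)
  exact ((Matrix.isUnit_iff_isUnit_det _).mp (h.mp hI')).ne_zero

omit [Fintype ι] in
theorem le_rank_of_minor_ne_zero (M : Matrix ι κ K) {r : ℕ} (I : Fin r → ι) (J : Fin r → κ)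
    (h : (M.submatrix I J).det ≠ 0) : r ≤ M.rank := by
  have := Matrix.rank_of_det_ne_zero h
  rw [Fintype.card_fin] at this
  exact this ▸ Matrix.rank_submatrix_le M I J

end Rank

/-! ### The Jacobian criterion for algebraic independence -/

section Jacobian

/-- A derivation that maps a set into a submodule `W` maps into `W` every element
that is algebraic over the subalgebra generated by that set (in characteristic zero). -/
theorem derivation_mem_of_isAlgebraic {k A K : Type*} [Field k] [CharZero k] [CommRing A]
    [IsDomain A] [Algebra k A] [Field K] [Algebra A K] [FaithfulSMul A K] {E : Type*}
    [AddCommGroup E] [Module K E] [Module A E] [Module k E] [IsScalarTower A K E]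
    (d : Derivation k A E) (T : Set A) (W : Submodule K E) (hT : ∀ t ∈ T, d t ∈ W) (y : A)
    (hy : IsAlgebraic (Algebra.adjoin k T) y) : d y ∈ W := by
  have hsm : ∀ (a : A) (e : E), e ∈ W → a • e ∈ W := fun a e he => by
    rw [← algebraMap_smul K a e]; exact W.smul_mem _ he
  have hadj : ∀ a ∈ Algebra.adjoin k T, d a ∈ W := by
    intro a ha
    induction ha using Algebra.adjoin_induction with
    | mem x hx => exact hT x hx
    | algebraMap c => simp
    | add x y _ _ hx hy => rw [map_add]; exact W.add_mem hx hy
    | mul x y _ _ hx hy => rw [d.leibniz]; exact W.add_mem (hsm _ _ hy) (hsm _ _ hx)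
  -- Chain rule modulo `W`: the coefficients of `G` contribute only elements of `W`.
  have hpoly : ∀ G : Polynomial (Algebra.adjoin k T),
      d (Polynomial.aeval y G) - Polynomial.aeval y (Polynomial.derivative G) • d y ∈ W := by
    intro G
    induction G using Polynomial.induction_on' with
    | add p q hp hq =>
      simp only [map_add, add_smul]
      rw [add_sub_add_comm]
      exact W.add_mem hp hq
    | monomial n a =>
      rw [Polynomial.derivative_monomial, Polynomial.aeval_monomial, Polynomial.aeval_monomial,
        d.leibniz, d.leibniz_pow]
      have h : (algebraMap (Algebra.adjoin k T) A a) • n • y ^ (n - 1) • d y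
          + y ^ n • d (algebraMap (Algebra.adjoin k T) A a)
          - (algebraMap (Algebra.adjoin k T) A (a * n) * y ^ (n - 1)) • d y
          = y ^ n • d (algebraMap (Algebra.adjoin k T) A a) := by
        rw [← Nat.cast_smul_eq_nsmul A n, smul_smul, smul_smul, map_mul, map_natCast]
        abel
      rw [h]
      exact hsm _ _ (hadj _ a.2)
  obtain ⟨G, hG, hGmin⟩ : ∃ G : Polynomial (Algebra.adjoin k T),
      (G ≠ 0 ∧ Polynomial.aeval y G = 0) ∧ ∀ G' : Polynomial (Algebra.adjoin k T),
        (G' ≠ 0 ∧ Polynomial.aeval y G' = 0) → G.natDegree ≤ G'.natDegree := by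
    obtain ⟨G, h1, h2⟩ := exists_minimalFor_of_wellFoundedLT
      (fun G : Polynomial (Algebra.adjoin k T) => G ≠ 0 ∧ Polynomial.aeval y G = 0)
      Polynomial.natDegree hy
    exact ⟨G, h1, fun G' hG' => (le_total _ _).elim id (h2 hG')⟩
  have hpos : G.natDegree ≠ 0 := by
    intro h0
    obtain ⟨c, hc⟩ := Polynomial.natDegree_eq_zero.mp h0
    have h1 := hG.2
    rw [← hc, Polynomial.aeval_C] at h1
    have : c = 0 := by simpa using h1
    exact hG.1 (by rw [← hc, this, Polynomial.C_0])
  have hCZ : CharZero (Algebra.adjoin k T) := 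
    charZero_of_injective_algebraMap (algebraMap k (Algebra.adjoin k T)).injective
  -- `G` has minimal degree among the polynomials killing `y`, and in characteristic zero its
  -- derivative is nonzero of smaller degree.
  have hG' : Polynomial.aeval y (Polynomial.derivative G) ≠ 0 := by
    intro h0
    have hd : Polynomial.derivative G ≠ 0 := fun h =>
      hpos (Polynomial.derivative_eq_zero.mp h)
    exact absurd (hGmin _ ⟨hd, h0⟩) (not_le.mpr (Polynomial.natDegree_derivative_lt hpos))
  have h := hpoly G
  rw [hG.2, map_zero, zero_sub, W.neg_mem_iff, ← algebraMap_smul K] at h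
  exact (W.smul_mem_iff
    (by simpa using hG')).mp h

variable {ι : Type*} [Fintype ι]

/-- The gradient of a polynomial, with entries in the field of rational functions. -/
noncomputable def gradient : Derivation ℂ (MvPolynomial ι ℂ)
    (ι → FractionRing (MvPolynomial ι ℂ)) :=
  MvPolynomial.mkDerivation ℂ fun i => by classical exact Pi.single i 1

omit [Fintype ι] in
theorem gradient_apply (f : MvPolynomial ι ℂ) (i : ι) :
    gradient f i = algebraMap _ (FractionRing (MvPolynomial ι ℂ)) (MvPolynomial.pderiv i f) := by
  classical
  have h : (LinearMap.proj (R := MvPolynomial ι ℂ) i).compDer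
        (gradient (ι := ι)) =
      (Algebra.linearMap (MvPolynomial ι ℂ) (FractionRing (MvPolynomial ι ℂ))).compDer
        (MvPolynomial.pderiv i) := by
    refine MvPolynomial.derivation_ext fun j => ?_
    simp [gradient, MvPolynomial.mkDerivation_X, MvPolynomial.pderiv_X, Pi.single_apply, eq_comm,
      apply_ite]
  exact congrArg (fun D => D f) h

/-- The gradients of algebraically independent polynomials are linearly independent over the
rational functions. -/
theorem linearIndependent_gradient {q : ℕ} (f : Fin q → MvPolynomial ι ℂ)
    (hf : AlgebraicIndependent ℂ f) :
    LinearIndependent (FractionRing (MvPolynomial ι ℂ)) (fun α => gradient (f α)) := by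
  classical
  set K := FractionRing (MvPolynomial ι ℂ)
  -- The family is completed to a transcendence basis `T`, which has as many elements as there are
  -- variables. Every polynomial is algebraic over `ℂ[T]`, so the gradients of `T` span; by
  -- cardinality they are independent.
  obtain ⟨T, hT, hTb⟩ := exists_isTranscendenceBasis_superset hf.coe_range
  have hcard : Cardinal.mk T = Fintype.card ι := by
    rw [hTb.cardinalMk_eq_trdeg, MvPolynomial.trdeg_of_isDomain]
    simp
  have hfin : Finite T := by
    rw [← Cardinal.lt_aleph0_iff_finite, hcard]; exact Cardinal.natCast_lt_aleph0
  have := Fintype.ofFinite T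
  have hcard' : Fintype.card T = Module.finrank K (ι → K) := by
    rw [Module.finrank_fintype_fun_eq_card]
    rw [Cardinal.mk_fintype] at hcard
    exact_mod_cast hcard
  have halg := hTb.isAlgebraic
  rw [Subtype.range_coe] at halg
  set W := Submodule.span K (Set.range fun t : T => gradient (t : MvPolynomial ι ℂ)) with hW
  have hall : ∀ y : MvPolynomial ι ℂ, gradient y ∈ W := fun y =>
    derivation_mem_of_isAlgebraic gradient T W
      (fun t ht => Submodule.subset_span ⟨⟨t, ht⟩, rfl⟩) y (halg.isAlgebraic y)
  have htop : ⊤ ≤ W := by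
    rw [← (Pi.basisFun K ι).span_eq, Submodule.span_le]
    rintro _ ⟨i, rfl⟩
    have := hall (MvPolynomial.X i)
    rw [gradient, MvPolynomial.mkDerivation_X] at this
    simpa using this
  have hli := linearIndependent_of_top_le_span_of_card_eq_finrank htop hcard'
  exact hli.comp (fun α => (⟨f α, hT ⟨α, rfl⟩⟩ : T)) fun α β h =>
    hf.injective (congrArg Subtype.val h)

/-- The Jacobian matrix of a family of polynomials. -/
noncomputable def jacobian {q : ℕ} (f : Fin q → MvPolynomial ι ℂ) :
    Matrix (Fin q) ι (MvPolynomial ι ℂ) :=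
  Matrix.of fun α i => MvPolynomial.pderiv i (f α)

theorem exists_jacobian_minor_ne_zero {q : ℕ} (f : Fin q → MvPolynomial ι ℂ)
    (hf : AlgebraicIndependent ℂ f) :
    ∃ k : Fin q ↪ ι, ((jacobian f).submatrix id k).det ≠ 0 := by
  set φ := algebraMap (MvPolynomial ι ℂ) (FractionRing (MvPolynomial ι ℂ))
  have hrow : LinearIndependent (FractionRing (MvPolynomial ι ℂ)) ((jacobian f).map φ).row := by
    have := linearIndependent_gradient f hf
    convert this using 1
    ext α i
    simp [gradient_apply, jacobian, φ]
  have hrank := hrow.rank_matrix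
  rw [Fintype.card_fin] at hrank
  obtain ⟨I, J, hIJ⟩ := exists_minor_ne_zero _ hrank
  refine ⟨J, fun h0 => hIJ ?_⟩
  have h1 : ((jacobian f).map φ).submatrix I J
      = (((jacobian f).submatrix id J).map φ).submatrix I id := by
    ext; simp
  have hI := (Finite.injective_iff_bijective.mp I.injective)
  rw [h1]
  have h2 := Matrix.det_permute (Equiv.ofBijective I hI) (((jacobian f).submatrix id J).map φ)
  rw [Equiv.coe_ofBijective] at h2
  rw [h2, ← RingHom.mapMatrix_apply, ← RingHom.map_det, h0, map_zero, mul_zero]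

end Jacobian

/-! ### Left kernels of the canonical blocks -/

namespace Block

/-- The inequality `cols < rows` serves throughout as the test for a block to be vertical. -/
theorem exists_eq_vertical (β : Block) (h : β.cols < β.rows) : ∃ η, β = vertical η := by
  cases β with
  | vertical η => exact ⟨η, rfl⟩
  | jordan z n => simp [rows, cols] at h
  | horizontal ε => simp [rows, cols] at h

theorem vRows_eq (β : Block) : β.vRows = if β.cols < β.rows then β.cols + 1 else 0 := by
  cases β <;> simp [rows, cols, vRows]

theorem cols_relabel (σ : Option ℂ → Option ℂ) (β : Block) : (β.relabel σ).cols = β.cols := by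
  cases β <;> rfl

theorem rows_relabel (σ : Option ℂ → Option ℂ) (β : Block) : (β.relabel σ).rows = β.rows := by
  cases β <;> rfl

theorem sum_mul_ite_val {A : Type*} [CommRing A] {m : ℕ} (y : Fin m → A) (k : ℕ) :
    (∑ i : Fin m, y i * (if (i : ℕ) = k then 1 else 0)) = if h : k < m then y ⟨k, h⟩ else 0 := by
  split_ifs with h
  · rw [Finset.sum_eq_single ⟨k, h⟩]
    · simp
    · intro i _ hi
      rw [if_neg (fun h' => hi (Fin.ext h')), mul_zero]
    · simp
  · refine Finset.sum_eq_zero fun i _ => ?_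
    rw [if_neg (by have := i.2; omega), mul_zero]

theorem vecMul_diagOnes {m n : ℕ} (y : Fin m → ℂ) (j : Fin n) :
    (y ᵥ* diagOnes m n) j = if h : (j : ℕ) < m then y ⟨j, h⟩ else 0 := by
  rw [← sum_mul_ite_val]; rfl

theorem vecMul_subOnes {m n : ℕ} (y : Fin m → ℂ) (j : Fin n) :
    (y ᵥ* subOnes m n) j = if h : (j : ℕ) + 1 < m then y ⟨j + 1, h⟩ else 0 := by
  rw [← sum_mul_ite_val]; rfl

theorem vecMul_superOnes_zero {m n : ℕ} (y : Fin m → ℂ) (h : 0 < n) :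
    (y ᵥ* superOnes m n) ⟨0, h⟩ = 0 := by
  simp [superOnes, vecMul, dotProduct]

theorem vecMul_superOnes_succ {m n : ℕ} (y : Fin m → ℂ) (j : ℕ) (h : j + 1 < n) :
    (y ᵥ* superOnes m n) ⟨j + 1, h⟩ = if h : j < m then y ⟨j, h⟩ else 0 := by
  rw [← sum_mul_ite_val]; simp [superOnes, vecMul, dotProduct]

/-- For a parameter `t` that is not the negative of an eigenvalue, a vector in the left kernel of
the pencil of a block vanishes, provided that its last coordinate is zero if the block is
vertical. -/
theorem eq_zero_of_vecMul_eq_zero (β : Block) (t : ℂ)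
    (ht : ∀ z n, β = jordan (some z) n → z + t ≠ 0) (y : Fin β.rows → ℂ)
    (hy : y ᵥ* (β.matA + t • β.matB) = 0)
    (hlast : ∀ h : β.cols < β.rows, y ⟨β.cols, h⟩ = 0) : y = 0 := by
  have hy' : ∀ j, (y ᵥ* β.matA) j + t * (y ᵥ* β.matB) j = 0 := fun j => by
    have := congrFun hy j
    rwa [vecMul_add, vecMul_smul] at this
  suffices H : ∀ (k : ℕ) (hk : k < β.rows), y ⟨k, hk⟩ = 0 from funext fun i => H i i.2
  cases β with
  | jordan z n =>
    cases z with
    | none =>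
      intro k hk
      have hk' : k < n + 1 := hk
      have h := hy' ⟨k, hk⟩
      simp only [matA, matB] at h
      erw [vecMul_diagOnes, dif_pos hk] at h
      induction k with
      | zero =>
        erw [vecMul_superOnes_zero] at h
        simpa using h
      | succ k ih =>
        erw [vecMul_superOnes_succ, dif_pos (show k < n + 1 by omega)] at h
        have h0 : y ⟨k, show k < n + 1 by omega⟩ = 0 := by
          refine ih (show k < n + 1 by omega) (by omega) ?_
          have h := hy' ⟨k, show k < n + 1 by omega⟩
          simp only [matA, matB] at h
          erw [vecMul_diagOnes, dif_pos (show k < n + 1 by omega)] at h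
          exact h
        rw [h0] at h
        simpa using h
    | some z =>
      have hz := ht z n rfl
      have key : ∀ (k : ℕ) (hk : k < n + 1),
          (z + t) * y ⟨k, hk⟩ + (y ᵥ* superOnes (n + 1) (n + 1)) ⟨k, hk⟩ = 0 := by
        intro k hk
        have h := hy' ⟨k, hk⟩
        simp only [matA, matB] at h
        erw [vecMul_add, vecMul_smul, Pi.add_apply, Pi.smul_apply, vecMul_diagOnes,
          dif_pos hk] at h
        rw [← h, smul_eq_mul]
        ring_nf
        rfl
      intro k hk
      have hk' : k < n + 1 := hk
      induction k with
      | zero =>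
        have h := key 0 hk'
        erw [vecMul_superOnes_zero] at h
        simpa [hz] using h
      | succ k ih =>
        have h := key (k + 1) hk'
        erw [vecMul_superOnes_succ, dif_pos (show k < n + 1 by omega),
          ih (show k < n + 1 by omega) (by omega)] at h
        simpa [hz] using h
  | horizontal ε =>
    have key : ∀ (k : ℕ) (hk : k < ε),
        y ⟨k, hk⟩ + t * (y ᵥ* superOnes ε (ε + 1)) ⟨k, by omega⟩ = 0 := by
      intro k hk
      have h := hy' ⟨k, show k < ε + 1 by omega⟩
      simp only [matA, matB] at h
      erw [vecMul_diagOnes, dif_pos hk] at h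
      exact h
    intro k hk
    have hk' : k < ε := hk
    induction k with
    | zero =>
      have h := key 0 hk'
      erw [vecMul_superOnes_zero] at h
      simpa using h
    | succ k ih =>
      have h := key (k + 1) hk'
      erw [vecMul_superOnes_succ, dif_pos (show k < ε by omega),
        ih (show k < ε by omega) (by omega)] at h
      simpa using h
  | vertical η =>
    have key : ∀ (k : ℕ) (hk : k < η),
        y ⟨k, show k < η + 1 by omega⟩ + t * y ⟨k + 1, show k + 1 < η + 1 by omega⟩ = 0 := by
      intro k hk
      have h := hy' ⟨k, hk⟩
      simp only [matA, matB] at h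
      erw [vecMul_diagOnes, vecMul_subOnes, dif_pos (show k < η + 1 by omega),
        dif_pos (show k + 1 < η + 1 by omega)] at h
      exact h
    -- Downward induction from the last coordinate, with `d` the distance to it.
    have H : ∀ (d k : ℕ) (hk : k + d = η), y ⟨k, show k < η + 1 by omega⟩ = 0 := by
      intro d
      induction d with
      | zero =>
        intro k hk
        obtain rfl : k = η := by omega
        exact hlast (Nat.lt_succ_self k)
      | succ d ih =>
        intro k hk
        have h := key k (by omega)
        rw [ih (k + 1) (by omega)] at h
        simpa using h
    intro k hk
    have hk' : k < η + 1 := hk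
    exact H (η - k) k (by omega)

/-- The polynomial left kernel of a vertical block is spanned by `((-X)^η, …, -X, 1)`. -/
theorem sum_pow_mul_eq_zero (β : Block) (h : β.cols < β.rows) (j : Fin β.cols) :
    ∑ k : Fin β.rows, (-Polynomial.X : Polynomial ℂ) ^ (β.cols - (k : ℕ)) *
      (Polynomial.C (β.matA k j) + Polynomial.X * Polynomial.C (β.matB k j)) = 0 := by
  obtain ⟨η, rfl⟩ := β.exists_eq_vertical h
  have hj : (j : ℕ) < η := j.2
  have h1 : ∀ k : Fin (η + 1), (-Polynomial.X : Polynomial ℂ) ^ (η - (k : ℕ)) *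
      (Polynomial.C ((vertical η).matA k j) + Polynomial.X * Polynomial.C ((vertical η).matB k j)) =
      (-Polynomial.X) ^ (η - (k : ℕ)) * (if (k : ℕ) = j then 1 else 0) +
      Polynomial.X * ((-Polynomial.X) ^ (η - (k : ℕ)) * (if (k : ℕ) = j + 1 then 1 else 0)) := by
    intro k
    have ha : (vertical η).matA k j = if (k : ℕ) = j then 1 else 0 := rfl
    have hb : (vertical η).matB k j = if (k : ℕ) = j + 1 then 1 else 0 := rfl
    rw [ha, hb, apply_ite Polynomial.C, apply_ite Polynomial.C, Polynomial.C_1, Polynomial.C_0]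
    ring
  have h2 := (Finset.sum_congr rfl fun k _ => h1 k : (∑ k : Fin (η + 1), _) = _)
  refine h2.trans ?_
  rw [Finset.sum_add_distrib, ← Finset.mul_sum,
    sum_mul_ite_val (fun k : Fin (η + 1) => (-Polynomial.X : Polynomial ℂ) ^ (η - (k : ℕ))),
    sum_mul_ite_val (fun k : Fin (η + 1) => (-Polynomial.X : Polynomial ℂ) ^ (η - (k : ℕ))),
    dif_pos (by omega), dif_pos (by omega)]
  obtain ⟨d, hd⟩ : ∃ d, η - (j : ℕ) = d + 1 := ⟨η - j - 1, by omega⟩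
  have hd' : η - ((j : ℕ) + 1) = d := by omega
  simp only [hd, hd']
  ring

theorem sum_pow_mul_eq_zero_of_eval (β : Block) (h : β.cols < β.rows) (j : Fin β.cols) (t : ℂ) :
    ∑ k : Fin β.rows, (-t) ^ (β.cols - (k : ℕ)) * (β.matA k j + t * β.matB k j) = 0 := by
  simpa [Polynomial.eval_finsetSum, mul_comm _ t] using congrArg (Polynomial.eval t) (β.sum_pow_mul_eq_zero h j)

end Block

/-! ### Vertical blocks, corank, and the polynomial left kernel -/

section KroneckerForm

/-- The positions of the vertical blocks in a list of blocks. -/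
abbrev VerticalIndex (L : List Block) : Type :=
  {i : Fin L.length // (L.get i).cols < (L.get i).rows}

/-- The number of vertical blocks. -/
def verticalCount (L : List Block) : ℕ :=
  (L.map fun β => if β.cols < β.rows then 1 else 0).sum

theorem sum_map_eq (L : List Block) (g : Block → ℕ) :
    (L.map g).sum = ∑ i : Fin L.length, g (L.get i) := by
  conv_lhs => rw [← List.ofFn_get L, List.map_ofFn, List.sum_ofFn]
  rfl

theorem card_verticalIndex (L : List Block) :
    Fintype.card (VerticalIndex L) = verticalCount L := by
  rw [verticalCount, sum_map_eq, Fintype.card_subtype, Finset.card_filter]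

theorem sum_vRows (L : List Block) :
    (L.map Block.vRows).sum = (∑ i : VerticalIndex L, (L.get i).cols) + verticalCount L := by
  rw [← card_verticalIndex, sum_map_eq, Fintype.card_eq_sum_ones, ← Finset.sum_add_distrib]
  simp only [Block.vRows_eq]
  rw [← Finset.sum_filter]
  exact Finset.sum_subtype _ (by simp) (fun i => (L.get i).cols + 1)

theorem verticalCount_relabel (L : List Block) (σ : Option ℂ → Option ℂ) :
    verticalCount (L.map (Block.relabel σ)) = verticalCount L := by
  simp [verticalCount, Function.comp_def, Block.cols_relabel, Block.rows_relabel]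

theorem verticalCount_perm {L L' : List Block} (h : L.Perm L') :
    verticalCount L = verticalCount L' :=
  (h.map _).sum_eq

variable {U V : Type*} [AddCommGroup U] [Module ℂ U] [AddCommGroup V] [Module ℂ V]

theorem IsKroneckerForm.repr_add_smul {A B : U →ₗ[ℂ] V} {L : List Block}
    {bU : Module.Basis (Σ i : Fin L.length, Fin (L.get i).cols) ℂ U}
    {bV : Module.Basis (Σ i : Fin L.length, Fin (L.get i).rows) ℂ V}
    (hA : LinearMap.toMatrix bU bV A = Matrix.blockDiagonal' (fun i => (L.get i).matA))
    (hB : LinearMap.toMatrix bU bV B = Matrix.blockDiagonal' (fun i => (L.get i).matB))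
    (t : ℂ) (p : Σ i : Fin L.length, Fin (L.get i).rows)
    (j : Σ i : Fin L.length, Fin (L.get i).cols) :
    bV.repr ((A + t • B) (bU j)) p =
      Matrix.blockDiagonal' (fun i => (L.get i).matA) p j +
        t * Matrix.blockDiagonal' (fun i => (L.get i).matB) p j := by
  rw [← hA, ← hB, LinearMap.toMatrix_apply, LinearMap.toMatrix_apply]
  simp

/-- Each vertical block supplies a functional with coefficients `(-t)^(η - k)` that kills the range.
The functionals stay independent for every `t`, since the coefficient at the last row is `1`, also
for `t = 0`. -/
theorem IsKroneckerForm.finrank_range_add_le {A B : U →ₗ[ℂ] V} {L : List Block}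
    (h : IsKroneckerForm A B L) (t : ℂ) :
    Module.finrank ℂ (LinearMap.range (A + t • B)) + verticalCount L ≤ Module.finrank ℂ V := by
  classical
  obtain ⟨bU, bV, hA, hB⟩ := h
  have := Module.Finite.of_basis bV
  let last : VerticalIndex L → Σ i : Fin L.length, Fin (L.get i).rows :=
    fun i => ⟨i.1, ⟨(L.get i.1).cols, i.2⟩⟩
  let Φ : V →ₗ[ℂ] (VerticalIndex L → ℂ) := LinearMap.pi fun i =>
    ∑ k : Fin (L.get i.1).rows, (-t) ^ ((L.get i.1).cols - (k : ℕ)) • bV.coord ⟨i.1, k⟩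
  have hΦlast : ∀ i, Φ (bV (last i)) = Pi.single i 1 := by
    intro i
    ext j
    by_cases hij : i = j
    · subst hij
      simp [Φ, last, Finsupp.single_apply]
    · have hne : ∀ k, last i ≠ ⟨j.1, k⟩ := fun k hk =>
        hij (Subtype.ext (congrArg Sigma.fst hk))
      simp [Φ, hne, Ne.symm hij]
  have hsurj : LinearMap.range Φ = ⊤ := by
    rw [LinearMap.range_eq_top]
    intro w
    refine ⟨∑ i, w i • bV (last i), ?_⟩
    simp only [map_sum, map_smul, hΦlast]
    ext j
    simp [Pi.single_apply]
  have hker : LinearMap.range (A + t • B) ≤ LinearMap.ker Φ := by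
    rw [LinearMap.range_le_ker_iff]
    refine bU.ext fun ⟨i', j⟩ => ?_
    ext i
    have hΦ : Φ ((A + t • B) (bU ⟨i', j⟩)) i =
        ∑ k : Fin (L.get i.1).rows, (-t) ^ ((L.get i.1).cols - (k : ℕ)) *
          (bV.repr ((A + t • B) (bU ⟨i', j⟩)) ⟨i.1, k⟩) := by
      simp only [Φ, LinearMap.pi_apply, LinearMap.sum_apply, LinearMap.smul_apply,
        Module.Basis.coord_apply, smul_eq_mul]
    rw [LinearMap.comp_apply, hΦ, LinearMap.zero_apply, Pi.zero_apply]
    simp only [IsKroneckerForm.repr_add_smul hA hB]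
    by_cases hi : i.1 = i'
    · subst hi
      simp only [Matrix.blockDiagonal'_apply_eq]
      exact (L.get i.1).sum_pow_mul_eq_zero_of_eval i.2 j t
    · simp [Matrix.blockDiagonal'_apply_ne _ _ _ hi]
  have h1 := LinearMap.finrank_range_add_finrank_ker Φ
  rw [hsurj, finrank_top, Module.finrank_fintype_fun_eq_card, card_verticalIndex] at h1
  have h2 := Submodule.finrank_mono hker
  omega

/-- Away from the negatives of the finite eigenvalues, a functional killing the range is determined
by its values at the last rows of the vertical blocks, so the corank is at most their number. -/
theorem IsKroneckerForm.exists_le_finrank_range_add {A B : U →ₗ[ℂ] V} {L : List Block}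
    (h : IsKroneckerForm A B L) :
    ∃ t : ℂ, Module.finrank ℂ V ≤
      Module.finrank ℂ (LinearMap.range (A + t • B)) + verticalCount L := by
  classical
  obtain ⟨bU, bV, hA, hB⟩ := h
  have := Module.Finite.of_basis bV
  -- Blocks without a finite eigenvalue get the dummy value `0`; excluding it as well is harmless,
  -- as only finitely many `t` are excluded.
  let bad : Fin L.length → ℂ := fun i =>
    match L.get i with
    | Block.jordan (some z) _ => -z
    | _ => 0
  obtain ⟨t, ht⟩ := (Set.finite_range bad).exists_notMem
  refine ⟨t, ?_⟩
  have ht' : ∀ i z n, L.get i = Block.jordan (some z) n → z + t ≠ 0 := by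
    intro i z n hi h0
    refine ht ⟨i, ?_⟩
    simp only [bad, hi]
    linear_combination -h0
  let last : VerticalIndex L → Σ i : Fin L.length, Fin (L.get i).rows :=
    fun i => ⟨i.1, ⟨(L.get i.1).cols, i.2⟩⟩
  let Ψ : Module.Dual ℂ V →ₗ[ℂ] (VerticalIndex L → ℂ) :=
    LinearMap.pi fun i => Module.Dual.eval ℂ V (bV (last i))
  set W := (LinearMap.range (A + t • B)).dualAnnihilator
  have hinj : Function.Injective (Ψ.domRestrict W) := by
    rw [← LinearMap.ker_eq_bot, LinearMap.ker_eq_bot']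
    rintro ⟨φ, hφ⟩ h0
    have h0' : ∀ i, φ (bV (last i)) = 0 := fun i => congrFun h0 i
    rw [Submodule.mem_dualAnnihilator] at hφ
    suffices H : ∀ i, (fun k => φ (bV ⟨i, k⟩)) = 0 by
      refine Subtype.ext (bV.ext fun ⟨i, k⟩ => ?_)
      simpa using congrFun (H i) k
    intro i
    refine (L.get i).eq_zero_of_vecMul_eq_zero t (ht' i) _ ?_ fun hi => h0' ⟨i, hi⟩
    ext j
    have h1 := hφ _ (LinearMap.mem_range_self (A + t • B) (bU ⟨i, j⟩))
    rw [← bV.sum_repr ((A + t • B) (bU ⟨i, j⟩)), map_sum] at h1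
    simp only [map_smul, smul_eq_mul, IsKroneckerForm.repr_add_smul hA hB] at h1
    rw [Fintype.sum_sigma, Finset.sum_eq_single i] at h1
    · rw [Pi.zero_apply, ← h1]
      simp [vecMul, dotProduct, Matrix.blockDiagonal'_apply_eq, mul_comm]
    · intro i' _ hi'
      refine Finset.sum_eq_zero fun k _ => ?_
      simp [Matrix.blockDiagonal'_apply_ne _ _ _ hi']
    · simp
  have h1 := LinearMap.finrank_le_finrank_of_injective hinj
  rw [Module.finrank_fintype_fun_eq_card, card_verticalIndex] at h1
  have h2 : _ + Module.finrank ℂ W = _ :=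
    Subspace.finrank_add_finrank_dualAnnihilator_eq (LinearMap.range (A + t • B))
  omega

/-- The matrix of the pencil `A + X B`, with polynomial entries. -/
noncomputable def pencilMatrix {ι κ : Type*} (MA MB : Matrix ι κ ℂ) :
    Matrix ι κ (Polynomial ℂ) :=
  Matrix.of fun i j => Polynomial.C (MA i j) + Polynomial.X * Polynomial.C (MB i j)

theorem pencilMatrix_eq {ι κ : Type*} (MA MB : Matrix ι κ ℂ) : pencilMatrix MA MB =
    MA.map Polynomial.C + (Polynomial.X : Polynomial ℂ) • MB.map Polynomial.C := by
  ext; simp [pencilMatrix]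

theorem pencilMatrix_mul_mul {ι κ ι' κ' : Type*} [Fintype ι] [Fintype κ] (MA MB : Matrix ι κ ℂ)
    (P : Matrix ι' ι ℂ) (Q : Matrix κ κ' ℂ) :
    pencilMatrix (P * MA * Q) (P * MB * Q) =
      P.map Polynomial.C * pencilMatrix MA MB * Q.map Polynomial.C := by
  rw [pencilMatrix_eq, pencilMatrix_eq, Matrix.map_mul, Matrix.map_mul, Matrix.map_mul, Matrix.map_mul, Matrix.mul_add,
    Matrix.add_mul, Matrix.mul_smul, Matrix.smul_mul]

/-- A polynomial basis of the left kernel of a pencil: one of its maximal minors is `1` and another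
one is a power of `-X` whose exponent is the sum of the minimal row indices. -/
theorem IsKroneckerForm.exists_left_kernel {A B : U →ₗ[ℂ] V} {L : List Block}
    (h : IsKroneckerForm A B L) {ι κ : Type*} [Fintype ι] [Fintype κ] [DecidableEq κ]
    (b : Module.Basis ι ℂ V) (c : Module.Basis κ ℂ U) {q : ℕ} (hq : verticalCount L = q) :
    ∃ (v : Matrix (Fin q) ι (Polynomial ℂ)) (C₀ C₁ : Matrix ι (Fin q) ℂ),
      v * pencilMatrix (LinearMap.toMatrix c b A) (LinearMap.toMatrix c b B) = 0 ∧
      (v * C₁.map Polynomial.C).det = 1 ∧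
      (v * C₀.map Polynomial.C).det =
        (-Polynomial.X) ^ (∑ i : VerticalIndex L, (L.get i).cols) := by
  classical
  obtain ⟨bU, bV, hA, hB⟩ := h
  let ε : Fin q ≃ VerticalIndex L :=
    Fintype.equivOfCardEq (by rw [Fintype.card_fin, card_verticalIndex, hq])
  let v' : Matrix (Fin q) (Σ i : Fin L.length, Fin (L.get i).rows) (Polynomial ℂ) :=
    Matrix.of fun α p => if (ε α).1 = p.1 then
      (-Polynomial.X) ^ ((L.get p.1).cols - (p.2 : ℕ)) else 0
  let last : Fin q → Σ i : Fin L.length, Fin (L.get i).rows :=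
    fun α => ⟨(ε α).1, ⟨(L.get (ε α).1).cols, (ε α).2⟩⟩
  let first : Fin q → Σ i : Fin L.length, Fin (L.get i).rows :=
    fun α => ⟨(ε α).1, ⟨0, lt_of_le_of_lt (Nat.zero_le _) (ε α).2⟩⟩
  -- Columns of the adapted basis, written in `b`, pick out columns of `v'`. The last rows of the
  -- vertical blocks give the identity, the first rows a diagonal matrix of powers of `-X`.
  have hsel : ∀ s : Fin q → Σ i : Fin L.length, Fin (L.get i).rows,
      v' * (bV.toMatrix b).map Polynomial.C *
        (b.toMatrix fun α => bV (s α)).map Polynomial.C = v'.submatrix id s := by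
    intro s
    rw [Matrix.mul_assoc, ← Matrix.map_mul, Module.Basis.toMatrix_mul_toMatrix]
    ext α β
    simp [Matrix.mul_apply, Module.Basis.toMatrix_apply, Finsupp.single_apply]
  have hv0 : v' * pencilMatrix (Matrix.blockDiagonal' fun i => (L.get i).matA)
      (Matrix.blockDiagonal' fun i => (L.get i).matB) = 0 := by
    ext1 α ⟨i, j⟩
    rw [Matrix.mul_apply, Fintype.sum_sigma, Finset.sum_eq_single (ε α).1]
    · by_cases hi : (ε α).1 = i
      · subst hi
        simp only [v', pencilMatrix, Matrix.of_apply, if_true, Matrix.blockDiagonal'_apply_eq]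
        exact (L.get (ε α).1).sum_pow_mul_eq_zero (ε α).2 j
      · refine Finset.sum_eq_zero fun k _ => ?_
        simp [pencilMatrix, Matrix.blockDiagonal'_apply_ne _ _ _ hi]
    · intro i' _ hi'
      refine Finset.sum_eq_zero fun k _ => ?_
      simp [v', hi'.symm]
    · simp
  have hinj : ∀ α β, (ε α).1 = (ε β).1 ↔ α = β := fun α β => by
    rw [Subtype.coe_inj, ε.apply_eq_iff_eq]
  refine ⟨v' * (bV.toMatrix b).map Polynomial.C, b.toMatrix fun α => bV (first α),
    b.toMatrix fun α => bV (last α), ?_, ?_, ?_⟩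
  · rw [← basis_toMatrix_mul_linearMap_toMatrix_mul_basis_toMatrix c bU b bV A,
      ← basis_toMatrix_mul_linearMap_toMatrix_mul_basis_toMatrix c bU b bV B, hA, hB,
      pencilMatrix_mul_mul, ← Matrix.mul_assoc, ← Matrix.mul_assoc,
      Matrix.mul_assoc v', ← Matrix.map_mul, Module.Basis.toMatrix_mul_toMatrix_flip]
    rw [Matrix.map_one _ Polynomial.C_0 Polynomial.C_1, Matrix.mul_one, hv0,
      Matrix.zero_mul]
  · rw [hsel]
    have : v'.submatrix id last = 1 := by
      ext1 α β
      simp [v', last, Matrix.one_apply, hinj]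
    rw [this, Matrix.det_one]
  · rw [hsel]
    have : v'.submatrix id first =
        Matrix.diagonal fun α => (-Polynomial.X) ^ (L.get (ε α).1).cols := by
      ext1 α β
      by_cases h : α = β
      · subst h; simp [v', first]
      · simp [v', first, hinj, h]
    rw [this, Matrix.det_diagonal, Finset.prod_pow_eq_pow_sum,
      Equiv.sum_comp ε fun i : VerticalIndex L => (L.get i.1).cols]

end KroneckerForm

/-! ### Restriction to lines and degrees of determinants -/

section Line

variable {σ : Type*}

/-- The restriction of polynomials to the line `x + X a`. -/
noncomputable def lineHom (x a : σ → ℂ) : MvPolynomial σ ℂ →ₐ[ℂ] Polynomial ℂ :=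
  MvPolynomial.aeval fun i => Polynomial.C (x i) + Polynomial.X * Polynomial.C (a i)

theorem natDegree_lineHom_le (x a : σ → ℂ) (p : MvPolynomial σ ℂ) :
    (lineHom x a p).natDegree ≤ p.totalDegree := by
  have h := MvPolynomial.aeval_natDegree_le (m := p.totalDegree) (n := 1) p le_rfl
    (fun i => Polynomial.C (x i) + Polynomial.X * Polynomial.C (a i)) fun i => by
      rw [add_comm, Polynomial.X_mul_C]; exact Polynomial.natDegree_linear_le
  simpa [lineHom] using h

theorem eval_lineHom (x a : σ → ℂ) (p : MvPolynomial σ ℂ) (t : ℂ) :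
    (lineHom x a p).eval t = MvPolynomial.eval (fun i => x i + t * a i) p := by
  have h : (Polynomial.evalRingHom t).comp (lineHom x a : MvPolynomial σ ℂ →+* Polynomial ℂ) =
      MvPolynomial.eval (fun i => x i + t * a i) := by
    refine MvPolynomial.ringHom_ext (fun c => ?_) fun i => ?_
    · simp [lineHom]
    · simp [lineHom, mul_comm t]
  exact congrArg (fun φ => φ p) h

end Line

theorem totalDegree_det_le {σ : Type*} {q : ℕ} (M : Matrix (Fin q) (Fin q) (MvPolynomial σ ℂ))
    (d : Fin q → ℕ) (h : ∀ i j, (M i j).totalDegree ≤ d i) : M.det.totalDegree ≤ ∑ i, d i := by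
  rw [← Matrix.det_transpose, Matrix.det_apply]
  refine MvPolynomial.totalDegree_finsetSum_le fun τ _ => ?_
  refine (MvPolynomial.totalDegree_smul_le _ _).trans ?_
  refine (MvPolynomial.totalDegree_finsetProd _ _).trans ?_
  exact Finset.sum_le_sum fun i _ => h i (τ i)

/-! ### Rank of `R_x` and generic pairs -/

section Representation

variable {𝔤 V : Type*} [LieRing 𝔤] [LieAlgebra ℂ 𝔤] [AddCommGroup V] [Module ℂ V]
  (ρ : 𝔤 →ₗ⁅ℂ⁆ Module.End ℂ V)

theorem R_add_smul (x a : V) (t : ℂ) : R ρ (x + t • a) = R ρ x + t • R ρ a := by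
  simp [R]

theorem R_apply (x : V) (ξ : 𝔤) : R ρ x ξ = ρ ξ x := rfl

section

variable [FiniteDimensional ℂ V]

theorem bddAbove_finrank_range :
    BddAbove (Set.range fun x : V => Module.finrank ℂ (LinearMap.range (R ρ x))) :=
  ⟨Module.finrank ℂ V, by rintro _ ⟨x, rfl⟩; exact Submodule.finrank_le _⟩

theorem finrank_range_le_dimRegularOrbit (x : V) :
    Module.finrank ℂ (LinearMap.range (R ρ x)) ≤ dimRegularOrbit ρ :=
  le_ciSup (bddAbove_finrank_range ρ) x

theorem exists_finrank_range_eq :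
    ∃ x : V, Module.finrank ℂ (LinearMap.range (R ρ x)) = dimRegularOrbit ρ :=
  Nat.sSup_mem (Set.range_nonempty _) (bddAbove_finrank_range ρ)

theorem dimRegularOrbit_le : dimRegularOrbit ρ ≤ Module.finrank ℂ V :=
  ciSup_le fun _ => Submodule.finrank_le _

theorem IsRegular.finrank_range_eq [FiniteDimensional ℂ 𝔤] {ρ : 𝔤 →ₗ⁅ℂ⁆ Module.End ℂ V} {x : V}
    (h : IsRegular ρ x) :
    Module.finrank ℂ (LinearMap.range (R ρ x)) = dimRegularOrbit ρ := by
  obtain ⟨y, hy⟩ := exists_finrank_range_eq ρ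
  have h1 := LinearMap.finrank_range_add_finrank_ker (R ρ x)
  have h2 := LinearMap.finrank_range_add_finrank_ker (R ρ y)
  have h3 := finrank_range_le_dimRegularOrbit ρ x
  have h4 := h y
  omega

end

variable {ι κ : Type*} [Fintype ι] [Fintype κ] (b : Module.Basis ι ℂ V) (c : Module.Basis κ ℂ 𝔤)

omit [Fintype κ] in
theorem eval_genericMatrix (x : V) (i : ι) (j : κ) :
    MvPolynomial.eval (b.repr x) (genericMatrix ρ b c i j) = b.repr (R ρ x (c j)) i := by
  rw [R_apply]
  conv_rhs => rw [← b.sum_repr x, map_sum, map_sum, Finsupp.finsetSum_apply]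
  simp [genericMatrix, mul_comm]

theorem lineHom_genericMatrix [DecidableEq κ] (x a : V) :
    (genericMatrix ρ b c).map (lineHom (b.repr x) (b.repr a)) =
      pencilMatrix (LinearMap.toMatrix c b (R ρ x)) (LinearMap.toMatrix c b (R ρ a)) := by
  ext1 i j
  refine Polynomial.funext fun t => ?_
  have h : (fun i => b.repr x i + t * b.repr a i) = b.repr (x + t • a) := by
    ext; simp
  rw [Matrix.map_apply, eval_lineHom, h, eval_genericMatrix, R_add_smul]
  simp [pencilMatrix, LinearMap.toMatrix_apply, mul_comm t]

theorem eval_minor [DecidableEq κ] (x : V)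
    (s : (Fin (dimRegularOrbit ρ) ↪ ι) × (Fin (dimRegularOrbit ρ) ↪ κ)) :
    MvPolynomial.eval (b.repr x) (minor ρ b c s) =
      ((LinearMap.toMatrix c b (R ρ x)).submatrix s.1 s.2).det := by
  rw [minor, RingHom.map_det]
  congr 1
  ext i j
  simp [eval_genericMatrix, LinearMap.toMatrix_apply]

theorem rank_toMatrix [DecidableEq κ] (x : V) :
    (LinearMap.toMatrix c b (R ρ x)).rank = Module.finrank ℂ (LinearMap.range (R ρ x)) := by
  rw [Matrix.rank_eq_finrank_range_toLin _ b c, Matrix.toLin_toMatrix]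

theorem exists_eval_minor_ne_zero (x : V)
    (hx : Module.finrank ℂ (LinearMap.range (R ρ x)) = dimRegularOrbit ρ) :
    ∃ s : (Fin (dimRegularOrbit ρ) ↪ ι) × (Fin (dimRegularOrbit ρ) ↪ κ),
      MvPolynomial.eval (b.repr x) (minor ρ b c s) ≠ 0 := by
  classical
  obtain ⟨I, J, h⟩ := exists_minor_ne_zero _ ((rank_toMatrix ρ b c x).trans hx)
  exact ⟨(I, J), by rwa [eval_minor]⟩

theorem finrank_range_eq_of_eval_minor_ne_zero (x : V)
    {s : (Fin (dimRegularOrbit ρ) ↪ ι) × (Fin (dimRegularOrbit ρ) ↪ κ)}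
    (hs : MvPolynomial.eval (b.repr x) (minor ρ b c s) ≠ 0) :
    Module.finrank ℂ (LinearMap.range (R ρ x)) = dimRegularOrbit ρ := by
  classical
  have := Module.Finite.of_basis b
  rw [eval_minor] at hs
  have := le_rank_of_minor_ne_zero _ _ _ hs
  rw [rank_toMatrix] at this
  exact le_antisymm (finrank_range_le_dimRegularOrbit ρ x) this

/-- Move `x` along the line to a point `y` of maximal rank, keeping `a` fixed. A polynomial of the
open set is nonzero at parameter `0` and a minor is nonzero at parameter `1`, so some parameter
keeps both nonzero. -/
theorem exists_mem_finrank_range_eq [FiniteDimensional ℂ 𝔤] [FiniteDimensional ℂ V]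
    {S : Set (V × V)} (hS : IsZariskiOpen S) (hne : S.Nonempty) :
    ∃ p ∈ S, Module.finrank ℂ (LinearMap.range (R ρ p.1)) = dimRegularOrbit ρ := by
  obtain ⟨T, rfl⟩ := hS
  obtain ⟨⟨x, a⟩, P, hP, hxa⟩ := hne
  obtain ⟨y, hy⟩ := exists_finrank_range_eq ρ
  let b := Module.finBasis ℂ V
  let c := Module.finBasis ℂ 𝔤
  obtain ⟨s, hs⟩ := exists_eval_minor_ne_zero ρ b c y hy
  have h1 : lineHom (fun φ : Module.Dual ℂ (V × V) => φ (x, a)) (fun φ => φ (y - x, 0)) P ≠ 0 := by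
    intro h0
    have := eval_lineHom (fun φ : Module.Dual ℂ (V × V) => φ (x, a)) (fun φ => φ (y - x, 0)) P 0
    rw [h0] at this
    exact hxa (by simpa using this.symm)
  have h2 : lineHom (b.repr x) (b.repr (y - x)) (minor ρ b c s) ≠ 0 := by
    intro h0
    have := eval_lineHom (b.repr x) (b.repr (y - x)) (minor ρ b c s) 1
    rw [h0] at this
    exact hs (by simpa using this.symm)
  obtain ⟨t, ht⟩ : ∃ t, (lineHom (fun φ : Module.Dual ℂ (V × V) => φ (x, a))
      (fun φ => φ (y - x, 0)) P * lineHom (b.repr x) (b.repr (y - x)) (minor ρ b c s)).eval t ≠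
      0 := by
    by_contra! h
    exact mul_ne_zero h1 h2 (Polynomial.funext fun t => by rw [h, Polynomial.eval_zero])
  rw [Polynomial.eval_mul, eval_lineHom, eval_lineHom] at ht
  refine ⟨(x + t • (y - x), a), ⟨P, hP, ?_⟩, ?_⟩
  · have h : (fun φ : Module.Dual ℂ (V × V) => φ (x + t • (y - x), a)) =
        fun φ => φ (x, a) + t * φ (y - x, 0) := by
      ext φ
      rw [← smul_eq_mul, ← map_smul, ← map_add]
      simp
    rw [h]
    exact left_ne_zero_of_mul ht
  · have h : (fun i => b.repr x i + t * b.repr (y - x) i) = b.repr (x + t • (y - x)) := by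
      ext; simp
    rw [h] at ht
    exact finrank_range_eq_of_eval_minor_ne_zero ρ b c _ (right_ne_zero_of_mul ht)

/-- For a generic pair `(x, a)` some point of the line `x + t a` has the maximal rank. -/
theorem IsGenericPair.exists_finrank_range_eq [FiniteDimensional ℂ 𝔤] [FiniteDimensional ℂ V]
    {ρ : 𝔤 →ₗ⁅ℂ⁆ Module.End ℂ V} {x a : V} (h : IsGenericPair ρ x a) :
    ∃ t : ℂ, Module.finrank ℂ (LinearMap.range (R ρ (x + t • a))) = dimRegularOrbit ρ := by
  obtain ⟨S, hS, hmem, htype⟩ := h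
  obtain ⟨p, hp, hrank⟩ := exists_mem_finrank_range_eq ρ hS ⟨_, hmem⟩
  obtain ⟨L, L', hL, hL', σ, hperm⟩ := htype _ hmem p hp
  -- At `t = 0` the rank is that of `R ρ p.1`, so the pencil at `p` has at most `dim V - r` vertical
  -- blocks. Constancy of the type carries this bound to `(x, a)`.
  have h1 := hL'.finrank_range_add_le 0
  rw [zero_smul, add_zero] at h1
  rw [← verticalCount_perm hperm, verticalCount_relabel] at h1
  obtain ⟨t, ht⟩ := hL.exists_le_finrank_range_add
  rw [← R_add_smul] at ht
  exact ⟨t, le_antisymm (finrank_range_le_dimRegularOrbit ρ _) (by simp only at ht; omega)⟩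

theorem verticalCount_eq [FiniteDimensional ℂ V] {x a : V} {L : List Block}
    (hL : IsKroneckerForm (R ρ x) (R ρ a) L)
    (h : ∃ t : ℂ, Module.finrank ℂ (LinearMap.range (R ρ (x + t • a))) = dimRegularOrbit ρ) :
    verticalCount L = codimRegularOrbit ρ := by
  obtain ⟨t, ht⟩ := h
  have h1 := hL.finrank_range_add_le t
  rw [← R_add_smul, ht] at h1
  obtain ⟨t', ht'⟩ := hL.exists_le_finrank_range_add
  rw [← R_add_smul] at ht'
  have h2 := finrank_range_le_dimRegularOrbit ρ (x + t' • a)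
  rw [codimRegularOrbit]
  omega

end Representation

/-! ### The degree count and the complement of `Sing₁` -/

section Invariants

variable {𝔤 V : Type*} [LieRing 𝔤] [LieAlgebra ℂ 𝔤] [AddCommGroup V] [Module ℂ V]
  (ρ : 𝔤 →ₗ⁅ℂ⁆ Module.End ℂ V)
  {ι κ : Type*} [Fintype ι] [Fintype κ] (b : Module.Basis ι ℂ V) (c : Module.Basis κ ℂ 𝔤)

omit [Fintype κ] in
theorem jacobian_mul_genericMatrix {q : ℕ} (f : Fin q → MvPolynomial ι ℂ)
    (hinv : ∀ α, IsInvariant ρ b (f α)) : jacobian f * genericMatrix ρ b c = 0 := by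
  ext1 α j
  refine MvPolynomial.funext fun z => ?_
  have hz : z = b.repr (b.equivFun.symm z) := by
    ext i
    rw [← b.equivFun_apply, LinearEquiv.apply_symm_apply]
  have h := congrArg (fun φ => φ (c j)) (hinv α (b.equivFun.symm z))
  rw [hz, Matrix.mul_apply, map_sum]
  simp only [map_mul, eval_genericMatrix]
  simpa [differential, jacobian] using h

theorem linearIndependent_differential {q : ℕ} (f : Fin q → MvPolynomial ι ℂ) (x : V)
    (k : Fin q → ι)
    (h : MvPolynomial.eval (b.repr x) ((jacobian f).submatrix id k).det ≠ 0) :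
    LinearIndependent ℂ (fun α => differential b (f α) x) := by
  let Φ : Module.Dual ℂ V →ₗ[ℂ] (Fin q → ℂ) :=
    LinearMap.pi fun j => Module.Dual.eval ℂ V (b (k j))
  refine LinearIndependent.of_comp Φ ?_
  rw [RingHom.map_det] at h
  have h1 := Matrix.linearIndependent_rows_of_det_ne_zero h
  have h2 : (Φ ∘ fun α => differential b (f α) x) =
      ((MvPolynomial.eval (b.repr x)).mapMatrix ((jacobian f).submatrix id k)).row := by
    ext α j
    simp only [Φ, differential, jacobian, Function.comp_apply, LinearMap.pi_apply,
      Module.Dual.eval_apply, LinearMap.sum_apply, LinearMap.smul_apply, Module.Basis.coord_apply,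
      Module.Basis.repr_self, smul_eq_mul, RingHom.mapMatrix_apply, Matrix.row_apply,
      Matrix.map_apply, Matrix.submatrix_apply, Matrix.of_apply, id_eq]
    rw [Finset.sum_eq_single (k j)]
    · simp
    · intro i _ hi
      rw [Finsupp.single_eq_of_ne hi, mul_zero]
    · simp
  rw [h2]
  exact h1

omit [Fintype ι] in
theorem one_le_totalDegree {q : ℕ} {f : Fin q → MvPolynomial ι ℂ} (hind : AlgebraicIndependent ℂ f)
    (α : Fin q) : 1 ≤ (f α).totalDegree := by
  by_contra! h
  have h0 : (f α).totalDegree = 0 := by omega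
  rw [MvPolynomial.totalDegree_eq_zero_iff_eq_C] at h0
  refine hind.transcendental α ?_
  rw [h0]
  exact isAlgebraic_algebraMap _

theorem totalDegree_det_jacobian_mul_le {q : ℕ} (f : Fin q → MvPolynomial ι ℂ)
    (hhom : ∀ α, (f α).IsHomogeneous (f α).totalDegree) (C : Matrix ι (Fin q) ℂ) :
    (Matrix.det (jacobian f *
      (C.map MvPolynomial.C : Matrix ι (Fin q) (MvPolynomial ι ℂ)))).totalDegree ≤
      ∑ α, ((f α).totalDegree - 1) := by
  refine totalDegree_det_le _ _ fun α j => ?_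
  rw [Matrix.mul_apply]
  refine MvPolynomial.totalDegree_finsetSum_le fun i _ => ?_
  refine (MvPolynomial.totalDegree_mul _ _).trans ?_
  rw [Matrix.map_apply, MvPolynomial.totalDegree_C, add_zero]
  exact ((hhom α).pderiv (i := i)).totalDegree_le

/-- If the sum of the degrees minus one does not exceed the sum of the minimal row indices of the
pencil `R_x + λ R_a`, where the line `x + λ a` contains a point of maximal rank, then the maximal
minors of the Jacobian matrix have no common factor of positive degree. -/
theorem isUnit_of_det_jacobian_mul_eq {q : ℕ} (f : Fin q → MvPolynomial ι ℂ)
    (hhom : ∀ α, (f α).IsHomogeneous (f α).totalDegree)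
    {x a : V} {L : List Block} (hL : IsKroneckerForm (R ρ x) (R ρ a) L)
    (hcount : verticalCount L = q)
    (hline : ∃ t : ℂ, Module.finrank ℂ (LinearMap.range (R ρ (x + t • a))) = dimRegularOrbit ρ)
    (hdeg : ∑ α, ((f α).totalDegree - 1) ≤ ∑ i : VerticalIndex L, (L.get i).cols)
    [DecidableEq ι] (e₀ : Fin (dimRegularOrbit ρ) ⊕ Fin q ≃ ι)
    (g : MvPolynomial ι ℂ) (u : Matrix ι (Fin q) (MvPolynomial ι ℂ) → MvPolynomial ι ℂ)
    (w : (Fin (dimRegularOrbit ρ) ↪ κ) → MvPolynomial ι ℂ) (hg : g ≠ 0)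
    (hu : ∀ C, (jacobian f * C).det = g * u C)
    (hw : ∀ (J : Fin (dimRegularOrbit ρ) ↪ κ) (C : Matrix ι (Fin q) (MvPolynomial ι ℂ)),
      completeDet e₀ ((genericMatrix ρ b c).submatrix id J) C = w J * u C) :
    IsUnit g := by
  classical
  obtain ⟨v, C₀, C₁, hv, hC₁, hC₀⟩ := hL.exists_left_kernel b c hcount
  rw [← lineHom_genericMatrix] at hv
  obtain ⟨t, ht⟩ := hline
  obtain ⟨⟨I, J⟩, hs⟩ := exists_eval_minor_ne_zero ρ b c _ ht
  set φ := lineHom (b.repr x) (b.repr a) with hφ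
  set M := (genericMatrix ρ b c).submatrix id J with hM
  have hvM : v * M.map (φ : MvPolynomial ι ℂ →+* Polynomial ℂ) = 0 := by
    ext1 i j
    exact congrFun (congrFun hv i) (J j)
  have hcard : Fintype.card ι = dimRegularOrbit ρ + q := by
    rw [← Fintype.card_congr e₀, Fintype.card_sum, Fintype.card_fin, Fintype.card_fin]
  obtain ⟨e, he⟩ := exists_equiv_inl hcard I I.injective
  have hmap : ∀ C, completeDet e₀ (M.map (φ : MvPolynomial ι ℂ →+* Polynomial ℂ))
      (C.map (φ : MvPolynomial ι ℂ →+* Polynomial ℂ)) = φ (w J) * φ (u C) := by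
    intro C
    rw [completeDet_map, hM, hw, map_mul]
    rfl
  have hconst : ∀ C : Matrix ι (Fin q) ℂ,
      (C.map MvPolynomial.C).map (φ : MvPolynomial ι ℂ →+* Polynomial ℂ) =
        C.map Polynomial.C := by
    intro C
    ext1 i j
    simp [hφ, lineHom]
  -- The minor `(I, J)` is nonzero at the parameter `t` of maximal rank, hence nonzero as a
  -- polynomial on the line.
  have hminor : completeDet e₀ (M.map (φ : MvPolynomial ι ℂ →+* Polynomial ℂ))
      (selectCols (Polynomial ℂ) e) ≠ 0 := by
    have h1 : (M.map (φ : MvPolynomial ι ℂ →+* Polynomial ℂ)).submatrix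
        (fun i => e (Sum.inl i)) id =
        ((genericMatrix ρ b c).submatrix I J).map (φ : MvPolynomial ι ℂ →+* Polynomial ℂ) := by
      ext1 i j
      simp [hM, he]
    rw [completeDet_selectCols, h1]
    refine mul_ne_zero ?_ fun h0 => hs ?_
    · rcases Int.units_eq_one_or (Equiv.Perm.sign (e₀.trans e.symm)) with h | h <;> simp [h]
    · rw [← RingHom.mapMatrix_apply, ← RingHom.map_det] at h0
      have h2 := eval_lineHom (b.repr x) (b.repr a) (minor ρ b c (I, J)) t
      have h3 : (fun i => b.repr x i + t * b.repr a i) = b.repr (x + t • a) := by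
        ext; simp
      rw [h3] at h2
      rw [← h2, minor]
      erw [h0]
      simp
  -- The kernel basis `v` annihilates the restricted columns just as the Jacobian matrix does, so
  -- its minors obey the same proportionality. Cancelling `φ (w J)` gives `φ (u C₁) * (-X)^(∑ η) = φ
  -- (u C₀)`.
  have hrel := completeDet_mul_det e₀ _ v hvM
  have h1 := hrel (C₁.map Polynomial.C) (selectCols (Polynomial ℂ) e)
  have h2 := hrel (C₁.map Polynomial.C) (C₀.map Polynomial.C)
  rw [hC₁, mul_one] at h1
  rw [hC₁, hC₀, mul_one, ← hconst, ← hconst, hmap, hmap, mul_assoc] at h2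
  have h3 : φ (w J) * φ (u (C₁.map MvPolynomial.C)) ≠ 0 := by
    rw [← hmap, hconst]
    intro h0
    rw [h0, zero_mul] at h1
    exact hminor h1.symm
  have h4 := mul_left_cancel₀ (left_ne_zero_of_mul h3) h2
  have hX : (-Polynomial.X : Polynomial ℂ) ≠ 0 := neg_ne_zero.mpr Polynomial.X_ne_zero
  have h5 : φ (u (C₀.map MvPolynomial.C)) ≠ 0 := by
    rw [← h4]
    exact mul_ne_zero (right_ne_zero_of_mul h3) (pow_ne_zero _ hX)
  have h6 : ∑ i : VerticalIndex L, (L.get i).cols ≤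
      (u (C₀.map MvPolynomial.C)).totalDegree := by
    refine le_trans ?_ (natDegree_lineHom_le (b.repr x) (b.repr a) _)
    rw [← hφ, ← h4, Polynomial.natDegree_mul (right_ne_zero_of_mul h3) (pow_ne_zero _ hX),
      Polynomial.natDegree_pow, Polynomial.natDegree_neg, Polynomial.natDegree_X, mul_one]
    exact Nat.le_add_left _ _
  have hu0 : u (C₀.map MvPolynomial.C) ≠ 0 := fun h0 => h5 (by rw [h0, map_zero])
  have h7 := totalDegree_det_jacobian_mul_le f hhom C₀
  -- Now `deg g + deg (u C₀) ≤ ∑ (deg f_α - 1) ≤ ∑ η ≤ deg (u C₀)`.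
  rw [hu, MvPolynomial.totalDegree_mul_of_isDomain hg hu0] at h7
  have h8 : g.totalDegree = 0 := by omega
  rw [MvPolynomial.isUnit_iff_totalDegree_of_isReduced]
  refine ⟨?_, h8⟩
  rw [MvPolynomial.totalDegree_eq_zero_iff_eq_C] at h8
  refine isUnit_iff_ne_zero.mpr fun h0 => hg ?_
  rw [h8, h0, MvPolynomial.C_0]

/-- A quotient `h` with `h(x) ≠ 0` satisfies `w' * u = ± h` with `w J = p * w'`. So a coordinate of
`u`, and with it a Jacobian minor because `g` is a unit, is nonzero at `x`. -/
theorem linearIndependent_of_notMem_Sing₁ {q : ℕ} (f : Fin q → MvPolynomial ι ℂ)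
    (hcard : Fintype.card ι = dimRegularOrbit ρ + q)
    (hind : AlgebraicIndependent ℂ f)
    (hhom : ∀ α, (f α).IsHomogeneous (f α).totalDegree)
    (hinv : ∀ α, IsInvariant ρ b (f α))
    {x₀ a₀ : V} {L : List Block} (hL : IsKroneckerForm (R ρ x₀) (R ρ a₀) L)
    (hcount : verticalCount L = q)
    (hline : ∃ t : ℂ, Module.finrank ℂ (LinearMap.range (R ρ (x₀ + t • a₀))) = dimRegularOrbit ρ)
    (hdeg : ∑ α, ((f α).totalDegree - 1) ≤ ∑ i : VerticalIndex L, (L.get i).cols)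
    {x : V} (hx : x ∉ Sing₁ ρ b c) :
    LinearIndependent ℂ (fun α => differential b (f α) x) := by
  classical
  obtain ⟨k, hk⟩ := exists_jacobian_minor_ne_zero f hind
  obtain ⟨e₀, he₀⟩ := exists_equiv_inr hcard k k.injective
  have hne : ∃ e : Fin (dimRegularOrbit ρ) ⊕ Fin q ≃ ι,
      (jacobian f * selectCols (MvPolynomial ι ℂ) e).det ≠ 0 := by
    refine ⟨e₀, ?_⟩
    rw [mul_selectCols]
    simpa only [he₀] using hk
  have hann : ∀ J : Fin (dimRegularOrbit ρ) ↪ κ,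
      jacobian f * (genericMatrix ρ b c).submatrix id J = 0 := by
    intro J
    ext1 i j
    exact congrFun (congrFun (jacobian_mul_genericMatrix ρ b c f hinv) i) (J j)
  obtain ⟨g, u, w, hg, hu, hw, hp⟩ := exists_primitive_vector e₀
    (fun J : Fin (dimRegularOrbit ρ) ↪ κ => (genericMatrix ρ b c).submatrix id J)
    (jacobian f) hann hne
  have hunit := isUnit_of_det_jacobian_mul_eq ρ b c f hhom hL hcount hline hdeg e₀ g u w hg hu hw
  set p := fundamentalSemiInvariant ρ b c with hpdef
  have hdvd : ∀ s, p ∣ minor ρ b c s := (exists_gcd (minor ρ b c)).choose_spec.1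
  simp only [Sing₁, Set.mem_ofPred_eq, not_forall] at hx
  obtain ⟨⟨I, J⟩, hmin, h, hh, hhx⟩ := hx
  obtain ⟨e, he⟩ := exists_equiv_inl hcard I I.injective
  have hcomp := completeDet_selectCols e₀ e ((genericMatrix ρ b c).submatrix id J)
  have hIJ : ((genericMatrix ρ b c).submatrix id J).submatrix (fun i => e (Sum.inl i)) id =
      (genericMatrix ρ b c).submatrix I J := by
    ext1 i j
    simp [he]
  obtain ⟨w', hw'⟩ : p ∣ w J := by
    refine hp p J fun e' => ?_
    rw [completeDet_selectCols]
    refine Dvd.dvd.mul_left ?_ _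
    exact hdvd (⟨fun i => e' (Sum.inl i), e'.injective.comp Sum.inl_injective⟩, J)
  have hmin' : ((genericMatrix ρ b c).submatrix I J).det = p * h := hh
  have hp0 : p ≠ 0 := by
    intro h0
    rw [hh, ← hpdef, h0, zero_mul] at hmin
    exact hmin rfl
  rw [hw, hIJ, hmin', hw'] at hcomp
  have hkey : w' * u (selectCols (MvPolynomial ι ℂ) e) =
      ((Equiv.Perm.sign (e₀.trans e.symm) : ℤ) : MvPolynomial ι ℂ) * h := by
    refine mul_left_cancel₀ hp0 ?_
    linear_combination hcomp
  have hux : MvPolynomial.eval (b.repr x) (u (selectCols (MvPolynomial ι ℂ) e)) ≠ 0 := by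
    intro h0
    have h1 := congrArg (MvPolynomial.eval (b.repr x)) hkey
    rw [map_mul, h0, mul_zero, map_mul] at h1
    refine hhx ?_
    rcases Int.units_eq_one_or (Equiv.Perm.sign (e₀.trans e.symm)) with h2 | h2
    · simpa [h2] using h1.symm
    · simpa [h2] using h1.symm
  refine linearIndependent_differential b f x (fun j => e (Sum.inr j)) ?_
  rw [← mul_selectCols, hu, map_mul]
  exact mul_ne_zero (hunit.map (MvPolynomial.eval (b.repr x))).ne_zero hux

/-- A minor that is nonzero at `x` factors as `p * h`, which forces `h(x) ≠ 0`. -/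
theorem IsRegular.notMem_Sing₁ [FiniteDimensional ℂ 𝔤] [FiniteDimensional ℂ V]
    {ρ : 𝔤 →ₗ⁅ℂ⁆ Module.End ℂ V} {x : V} (hx : IsRegular ρ x) : x ∉ Sing₁ ρ b c := by
  intro hmem
  obtain ⟨s, hs⟩ := exists_eval_minor_ne_zero ρ b c x hx.finrank_range_eq
  obtain ⟨h, hh⟩ : fundamentalSemiInvariant ρ b c ∣ minor ρ b c s :=
    (exists_gcd (minor ρ b c)).choose_spec.1 s
  have h0 := hmem s (fun h0 => hs (by rw [h0, map_zero])) h hh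
  rw [hh, map_mul, h0, mul_zero] at hs
  exact hs rfl

/-- If the total Kronecker `v`-index is not zero, it is read off from the canonical form of the
pencil of a generic pair. -/
theorem exists_isKroneckerForm_of_vIndex_ne_zero (h : vIndex ρ ≠ 0) :
    ∃ (x a : V) (L : List Block), IsGenericPair ρ x a ∧ IsKroneckerForm (R ρ x) (R ρ a) L ∧
      vIndex ρ = (L.map Block.vRows).sum := by
  rw [vIndex] at h ⊢
  split_ifs at h ⊢ with hp
  · rw [pencilVIndex] at h ⊢
    split_ifs at h ⊢ with hL
    · exact ⟨_, _, _, hp.choose_spec, hL.choose_spec, rfl⟩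
    · exact absurd rfl h
  · exact absurd rfl h

end Invariants

end JordanKronecker

/-! ### The proposition -/

theorem mainTheorem6
    {𝔤 V : Type*} [LieRing 𝔤] [LieAlgebra ℂ 𝔤] [FiniteDimensional ℂ 𝔤]
    [AddCommGroup V] [Module ℂ V] [FiniteDimensional ℂ V]
    (ρ : 𝔤 →ₗ⁅ℂ⁆ Module.End ℂ V)
    {ι κ : Type*} [Fintype ι] [Fintype κ]
    (b : Module.Basis ι ℂ V) (c : Module.Basis κ ℂ 𝔤)
    (q : ℕ) (hq : q = JordanKronecker.codimRegularOrbit ρ)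
    (f : Fin q → MvPolynomial ι ℂ)
    (hind : AlgebraicIndependent ℂ f)
    (hhom : ∀ α, (f α).IsHomogeneous (f α).totalDegree)
    (hinv : ∀ α, JordanKronecker.IsInvariant ρ b (f α))
    (hdeg : ∑ α, (f α).totalDegree = JordanKronecker.vIndex ρ) :
    (∀ x : V, x ∉ JordanKronecker.Sing₁ ρ b c →
      LinearIndependent ℂ (fun α => JordanKronecker.differential b (f α) x)) ∧
    (∀ x : V, JordanKronecker.IsRegular ρ x →
      LinearIndependent ℂ (fun α => JordanKronecker.differential b (f α) x)) := by
  suffices H : ∀ x : V, x ∉ JordanKronecker.Sing₁ ρ b c →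
      LinearIndependent ℂ (fun α => JordanKronecker.differential b (f α) x) from
    ⟨H, fun x hx => H x (hx.notMem_Sing₁ b c)⟩
  intro x hx
  -- For `q > 0` each degree is at least `1`, so the `v`-index is nonzero. It is then not a default
  -- value, and a generic pair with a canonical form is at hand without invoking their general
  -- existence.
  rcases Nat.eq_zero_or_pos q with hq0 | hq0
  · subst hq0
    exact linearIndependent_empty_type
  have hsum : ∑ α, ((f α).totalDegree - 1) + q = ∑ α, (f α).totalDegree := by
    calc ∑ α, ((f α).totalDegree - 1) + q = ∑ α, ((f α).totalDegree - 1 + 1) := by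
          rw [Finset.sum_add_distrib]; simp
      _ = ∑ α, (f α).totalDegree := Finset.sum_congr rfl fun α _ =>
          Nat.sub_add_cancel (JordanKronecker.one_le_totalDegree hind α)
  obtain ⟨x₀, a₀, L, hgen, hL, hv⟩ :=
    JordanKronecker.exists_isKroneckerForm_of_vIndex_ne_zero ρ (by omega)
  have hline := hgen.exists_finrank_range_eq
  have hcount : JordanKronecker.verticalCount L = q :=
    (JordanKronecker.verticalCount_eq ρ hL hline).trans hq.symm
  have hcard : Fintype.card ι = JordanKronecker.dimRegularOrbit ρ + q := by
    have h1 := JordanKronecker.dimRegularOrbit_le ρ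
    rw [hq, JordanKronecker.codimRegularOrbit, ← Module.finrank_eq_card_basis b]
    omega
  rw [JordanKronecker.sum_vRows, hcount] at hv
  exact JordanKronecker.linearIndependent_of_notMem_Sing₁ ρ b c f hcard hind hhom hinv hL hcount
    hline (by omega) hx
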